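/- **Setting.** Let $n\ge 0$. A *hive* for $\mathrm{GL}(n)$ is an array of integers $h=(h_{ij})_{1\le j\le i\le n+1}$ such that 1. $h_{11}=0$; 2. the rhombus conditions hold: $h_{i,j}+h_{i+1,j+1}\ge h_{i+1,j}+h_{i,j+1}$ and $h_{i,j}+h_{i,j+1}\ge h_{i+1,j+1}+h_{i-1,j}$ for $1\le j<i\le n$, and $h_{i+1,j}+h_{i,j}\ge h_{i+1,j+1}+h_{i,j-1}$ for $1<j\le i\le n$; 3. each of the three sequences $(h_{i+1,i+1}-h_{i,i})_{1\le i\le n}$, $(h_{i+1,1}-h_{i,1})_{1\le i\le n}$, $(h_{n+1,i+1}-h_{n+1,i})_{1\le i\le n}$ is weakly decreasing with non-negative terms. The entries of a hive are non-negative, and hives form a monoid under entrywise addition. The *hive algebra* $\mathrm{HA}(n)$ is the subalgebra of the polynomial algebra $\mathbb{C}[z_{ij}:1\le j\le i\le n+1]$ generated by the monomials $\mathbf{z}^h=\prod_{i,j}z_{ij}^{h_{ij}}$ over all hives $h$. Grade $\mathrm{HA}(n)$ by the degree in $z_{n+1,n+1}$, and let $$\mathfrak{HP}_n(t)=\sum_{d\ge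 0}m_d\,t^d,\qquad m_d=\dim_{\mathbb{C}}\mathrm{HA}(n)_d,$$ be its Hilbert–Poincaré (HP) series, where $\mathrm{HA}(n)_d$ is the $d$-homogeneous space. For a Young diagram $\kappa$ with at most $n$ rows let $s^\kappa_n=\sum_T\prod_{c\in\kappa}x_{T(c)}$ be the Schur polynomial in $n$ variables, where $T$ runs over the semistandard tableaux of shape $\kappa$ with entries in $\{1,\dots,n\}$. The *Littlewood–Richardson coefficients* $c^{\lambda}_{\mu\nu}\in\mathbb{Z}_{\ge0}$ for $\mathrm{GL}(n)$ are defined, for Young diagrams $\lambda,\mu,\nu$ with at most $n$ rows, by $$s^\mu_n\,s^\nu_n=\sum_\lambda c^\lambda_{\mu\nu}\,s^\lambda_n ,$$ a finite sum over Young diagrams $\lambda$ with at most $n$ rows. **Proposition.** For all $\mu,\nu$ the decomposition above exists with non-negative integer coefficients and these are unique, so that the $c^\lambda_{\mu\nu}$ are well defined. For every $d\ge0$ the space $\mathrm{HA}(n)_d$ is finite-dimensional, and the coefficient $m_d$ of $t^d$ in $\mathfrak{HP}_n(t)$ is $$m_d=\sum_{\substack{(\lambda,\mu,\nu):\\ |\lambda|=|\mu|+|\nu|=d}}c^\lambda_{\mu\nu},$$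 the sum being over all triples of Young diagrams with at most $n$ rows such that $|\lambda|=|\mu|+|\nu|=d$. -/

import Mathlib

namespace HiveAlg

/-! ### Triangular arrays and hives -/

/-- The index set `{(i, j) : 1 ≤ j ≤ i ≤ n + 1}` of triangular arrays for `GL(n)`. -/
abbrev Idx (n : ℕ) : Type :=
  ↥((Finset.Icc 1 (n + 1) ×ˢ Finset.Icc 1 (n + 1)).filter fun p : ℕ × ℕ => p.2 ≤ p.1)

/-- The corner index `(n + 1, n + 1)`. -/
def corner (n : ℕ) : Idx n := ⟨(n + 1, n + 1), by simp⟩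

/-- The entry `h_{ij}` of a triangular array, with 1-based indices.
The value `0` outside the triangle `1 ≤ j ≤ i ≤ n + 1` is never used below. -/
def entry {n : ℕ} (h : Idx n → ℤ) (i j : ℕ) : ℤ :=
  if hp : (i, j) ∈ (Finset.Icc 1 (n + 1) ×ˢ Finset.Icc 1 (n + 1)).filter
    fun p : ℕ × ℕ => p.2 ≤ p.1 then h ⟨(i, j), hp⟩ else 0

/-- `a_i = h_{i+1,i+1} - h_{i,i}` for `1 ≤ i ≤ n` (the component with index `i : Fin n` is the
one numbered `i + 1` in 1-based notation; the same holds for the other two boundary sides). -/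
def boundaryA {n : ℕ} (h : Idx n → ℤ) (i : Fin n) : ℤ :=
  entry h (i + 2) (i + 2) - entry h (i + 1) (i + 1)

/-- `b_i = h_{i+1,1} - h_{i,1}` for `1 ≤ i ≤ n`. -/
def boundaryB {n : ℕ} (h : Idx n → ℤ) (i : Fin n) : ℤ :=
  entry h (i + 2) 1 - entry h (i + 1) 1

/-- `c_i = h_{n+1,i+1} - h_{n+1,i}` for `1 ≤ i ≤ n`. -/
def boundaryC {n : ℕ} (h : Idx n → ℤ) (i : Fin n) : ℤ :=
  entry h (n + 1) (i + 2) - entry h (n + 1) (i + 1)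

/-- Non-negative dominant sequences `k_1 ≥ k_2 ≥ ... ≥ k_n ≥ 0`. -/
def NonnegDominant {n : ℕ} (k : Fin n → ℤ) : Prop := Antitone k ∧ ∀ i, 0 ≤ k i

/-- Hives for `GL(n)`. -/
structure IsHive {n : ℕ} (h : Idx n → ℤ) : Prop where
  apex : entry h 1 1 = 0
  rhombus₁ : ∀ i j : ℕ, 1 ≤ j → j < i → i ≤ n →
    entry h (i + 1) j + entry h i (j + 1) ≤ entry h i j + entry h (i + 1) (j + 1)
  rhombus₂ : ∀ i j : ℕ, 1 ≤ j → j < i → i ≤ n →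
    entry h (i + 1) (j + 1) + entry h (i - 1) j ≤ entry h i j + entry h i (j + 1)
  rhombus₃ : ∀ i j : ℕ, 1 < j → j ≤ i → i ≤ n →
    entry h (i + 1) (j + 1) + entry h i (j - 1) ≤ entry h (i + 1) j + entry h i j
  domA : NonnegDominant (boundaryA h)
  domB : NonnegDominant (boundaryB h)
  domC : NonnegDominant (boundaryC h)

theorem entry_add {n : ℕ} (h k : Idx n → ℤ) (i j : ℕ) :
    entry (h + k) i j = entry h i j + entry k i j := by
  unfold entry; split <;> simp

theorem entry_zero {n : ℕ} (i j : ℕ) : entry (0 : Idx n → ℤ) i j = 0 := by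
  unfold entry; split <;> simp

theorem NonnegDominant.add {n : ℕ} {k l : Fin n → ℤ} (hk : NonnegDominant k)
    (hl : NonnegDominant l) : NonnegDominant (k + l) :=
  ⟨hk.1.add hl.1, fun i => add_nonneg (hk.2 i) (hl.2 i)⟩

/-- The hive cone: the additive monoid of all hives for `GL(n)`. -/
def hiveCone (n : ℕ) : AddSubmonoid (Idx n → ℤ) where
  carrier := {h | IsHive h}
  zero_mem' := by
    refine ⟨?_, ?_, ?_, ?_, ⟨?_, ?_⟩, ⟨?_, ?_⟩, ⟨?_, ?_⟩⟩ <;>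
      simp [Antitone, boundaryA, boundaryB, boundaryC, entry_zero]
  add_mem' := by
    intro h k hh hk
    have eA : boundaryA (h + k) = boundaryA h + boundaryA k := by
      funext i; simp only [boundaryA, entry_add, Pi.add_apply]; ring
    have eB : boundaryB (h + k) = boundaryB h + boundaryB k := by
      funext i; simp only [boundaryB, entry_add, Pi.add_apply]; ring
    have eC : boundaryC (h + k) = boundaryC h + boundaryC k := by
      funext i; simp only [boundaryC, entry_add, Pi.add_apply]; ring
    refine ⟨?_, ?_, ?_, ?_, ?_, ?_, ?_⟩
    · rw [entry_add, hh.apex, hk.apex, add_zero]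
    · intro i j h1 h2 h3
      have := hh.rhombus₁ i j h1 h2 h3
      have := hk.rhombus₁ i j h1 h2 h3
      simp only [entry_add]; linarith
    · intro i j h1 h2 h3
      have := hh.rhombus₂ i j h1 h2 h3
      have := hk.rhombus₂ i j h1 h2 h3
      simp only [entry_add]; linarith
    · intro i j h1 h2 h3
      have := hh.rhombus₃ i j h1 h2 h3
      have := hk.rhombus₃ i j h1 h2 h3
      simp only [entry_add]; linarith
    · rw [eA]; exact hh.domA.add hk.domA
    · rw [eB]; exact hh.domB.add hk.domB
    · rw [eC]; exact hh.domC.add hk.domC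

/-! ### The hive algebra and its Hilbert-Poincare series -/

/-- The monomial `z^h = ∏ z_{ij}^{h_{ij}}`. It is used only for hives, whose entries are
non-negative (`IsHive.nonneg` below), so that `Int.toNat` does not change the exponents. -/
noncomputable def hiveMonomial {n : ℕ} (h : Idx n → ℤ) : MvPolynomial (Idx n) ℂ :=
  ∏ p : Idx n, MvPolynomial.X p ^ (h p).toNat

/-- All entries of a hive are non-negative. -/
theorem IsHive.nonneg {n : ℕ} {h : Idx n → ℤ} (hh : IsHive h) (p : Idx n) : 0 ≤ h p := by
  -- the left side is non-negative
  have hleft : ∀ i : ℕ, i ≤ n → 0 ≤ entry h (i + 1) 1 := by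
    intro i
    induction i with
    | zero => intro _; simp [hh.apex]
    | succ i ih =>
      intro hi
      have h1 := ih (by omega)
      have h2 := hh.domB.2 ⟨i, by omega⟩
      simp only [boundaryB] at h2
      have h3 : entry h (i + 2) 1 = entry h (i + 1 + 1) 1 := rfl
      linarith
  -- the last entry of each row dominates the one before it
  have hdiag : ∀ k i : ℕ, i + k = n → 1 ≤ i → entry h (i + 1) i ≤ entry h (i + 1) (i + 1) := by
    intro k
    induction k with
    | zero =>
      intro i hi h1
      have h2 := hh.domC.2 ⟨i - 1, by omega⟩
      simp only [boundaryC] at h2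
      rw [show i - 1 + 2 = i + 1 by omega, show i - 1 + 1 = i by omega] at h2
      rw [show i = n by omega] at h2 ⊢
      linarith
    | succ k ih =>
      intro i hi h1
      have h2 := ih (i + 1) (by omega) (by omega)
      have h3 := hh.rhombus₃ (i + 1) (i + 1) (by omega) le_rfl (by omega)
      simp only [Nat.add_sub_cancel] at h3
      linarith
  -- every row is non-decreasing
  have hrow : ∀ d i j : ℕ, i = j + d → 1 ≤ j → i ≤ n →
      entry h (i + 1) j ≤ entry h (i + 1) (j + 1) := by
    intro d
    induction d with
    | zero =>
      intro i j hij h1 h2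
      have hi : i = j := by omega
      subst hi
      exact hdiag (n - i) i (by omega) h1
    | succ d ih =>
      intro i j hij h1 h2
      have h3 := ih (j + d) j rfl h1 (by omega)
      have h4 := hh.rhombus₁ i j h1 (by omega) h2
      rw [show j + d + 1 = i by omega] at h3
      linarith
  have hall : ∀ j i : ℕ, j ≤ i → i ≤ n → 0 ≤ entry h (i + 1) (j + 1) := by
    intro j
    induction j with
    | zero => intro i _ hi; exact hleft i hi
    | succ j ih =>
      intro i hji hi
      have h1 := ih i (by omega) hi
      have h2 := hrow (i - (j + 1)) i (j + 1) (by omega) (by omega) hi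
      linarith
  obtain ⟨⟨i, j⟩, hp⟩ := p
  have hp' := hp
  simp only [Finset.mem_filter, Finset.mem_product, Finset.mem_Icc] at hp'
  have h1 := hall (j - 1) (i - 1) (by omega) (by omega)
  rw [show i - 1 + 1 = i by omega, show j - 1 + 1 = j by omega] at h1
  rwa [entry, dif_pos hp] at h1

/-- The hive algebra `HA(n)`: the subalgebra of `ℂ[z_{ij} : 1 ≤ j ≤ i ≤ n + 1]` generated by the
monomials `z^h` of all hives `h`. -/
noncomputable def hiveAlgebra (n : ℕ) : Subalgebra ℂ (MvPolynomial (Idx n) ℂ) :=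
  Algebra.adjoin ℂ (hiveMonomial '' (hiveCone n : Set (Idx n → ℤ)))

/-- The `d`-homogeneous space of `HA(n)`, for the grading by the degree in `z_{n+1,n+1}`. -/
noncomputable def homogeneousPart (n d : ℕ) : Submodule ℂ (hiveAlgebra n) :=
  (MvPolynomial.weightedHomogeneousSubmodule ℂ (Pi.single (corner n) 1 : Idx n → ℕ) d).comap
    (hiveAlgebra n).val.toLinearMap

/-- The Hilbert-Poincare series of `HA(n)`. -/
noncomputable def hpSeries (n : ℕ) : PowerSeries ℕ :=
  PowerSeries.mk fun d => Module.finrank ℂ (homogeneousPart n d)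

/-! ### Schur polynomials and Littlewood-Richardson coefficients -/

/-- Young diagrams with at most `n` rows. -/
abbrev Diagram (n : ℕ) : Type := {κ : YoungDiagram // κ.colLen 0 ≤ n}

/-- Semistandard tableaux of shape `κ` with entries in an alphabet of `n` letters
(`0, ..., n - 1`, in place of `1, ..., n`). -/
abbrev BoundedSSYT (n : ℕ) (κ : YoungDiagram) : Type :=
  {T : SemistandardYoungTableau κ // ∀ c ∈ κ.cells, T c.1 c.2 < n}

instance (n : ℕ) (κ : YoungDiagram) : Finite (BoundedSSYT n κ) := by
  refine Finite.of_injective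
    (fun (T : BoundedSSYT n κ) (c : κ.cells) => (⟨T.1 c.1.1 c.1.2, T.2 c.1 c.2⟩ : Fin n)) ?_
  intro T U hTU
  refine Subtype.ext (SemistandardYoungTableau.ext fun i j => ?_)
  by_cases hc : (i, j) ∈ κ
  · exact congrArg Fin.val (congrFun hTU ⟨(i, j), (YoungDiagram.mem_cells _).2 hc⟩)
  · rw [T.1.zeros hc, U.1.zeros hc]

noncomputable instance (n : ℕ) (κ : YoungDiagram) : Fintype (BoundedSSYT n κ) :=
  Fintype.ofFinite _

/-- The Schur polynomial `s^κ_n` in `n` variables: the sum over all semistandard tableaux `T` of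
shape `κ` with entries in the `n`-letter alphabet of `∏_c x_{T(c)}`, over all boxes `c` of `κ`. -/
noncomputable def schurPoly (n : ℕ) (κ : YoungDiagram) : MvPolynomial (Fin n) ℤ :=
  ∑ T : BoundedSSYT n κ, ∏ c : κ.cells, MvPolynomial.X ⟨T.1 c.1.1 c.1.2, T.2 c.1 c.2⟩

/-- `c` is the family of multiplicities in a decomposition
`s^μ_n s^ν_n = ∑_λ c(λ) s^λ_n`, where `λ` runs over Young diagrams with at most `n` rows. -/
def IsSchurDecomposition {n : ℕ} (μ ν : Diagram n) (c : Diagram n →₀ ℕ) : Prop :=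
  schurPoly n μ.1 * schurPoly n ν.1 = c.sum fun l m => m • schurPoly n l.1

/-- The Littlewood-Richardson coefficient `c^λ_{μν}` for `GL(n)`: the coefficient of `s^λ_n` in
the decomposition of `s^μ_n s^ν_n`. It is meaningful because this
decomposition exists and is unique, which the main theorem asserts as part of its conclusion. -/
noncomputable def lrCoeff {n : ℕ} (l μ ν : Diagram n) : ℕ :=
  Classical.epsilon (IsSchurDecomposition μ ν) l

theorem finite_diagrams (n d : ℕ) : {κ : Diagram n | κ.1.card ≤ d}.Finite := by
  have key : ∀ κ : YoungDiagram, κ.card ≤ d →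
      κ.cells ∈ (Finset.range d ×ˢ Finset.range d).powerset := by
    intro κ hκ
    rw [Finset.mem_powerset]
    rintro ⟨i, j⟩ hc
    have hc' : (i, j) ∈ κ := (YoungDiagram.mem_cells _).1 hc
    have hsub : Finset.range (i + 1) ×ˢ {j} ∪ {i} ×ˢ Finset.range (j + 1) ⊆ κ.cells := by
      rintro ⟨a, b⟩ hab
      simp only [Finset.mem_union, Finset.mem_product, Finset.mem_range,
        Finset.mem_singleton] at hab
      exact (YoungDiagram.mem_cells _).2 (κ.up_left_mem (by omega) (by omega) hc')
    have h1 := Finset.card_le_card (Finset.subset_union_left.trans hsub)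
    have h2 := Finset.card_le_card (Finset.subset_union_right.trans hsub)
    simp only [Finset.card_product, Finset.card_range, Finset.card_singleton] at h1 h2
    have h3 : κ.cells.card ≤ d := hκ
    simp only [Finset.mem_product, Finset.mem_range]
    omega
  refine Set.Finite.of_finite_image (f := fun κ : Diagram n => κ.1.cells)
    ((Finset.finite_toSet (Finset.range d ×ˢ Finset.range d).powerset).subset ?_) ?_
  · rintro _ ⟨κ, hκ, rfl⟩
    exact key κ.1 hκ
  · intro κ _ κ' _ h
    exact Subtype.ext (YoungDiagram.ext h)

theorem finite_triples (n d : ℕ) : {t : Diagram n × Diagram n × Diagram n |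
    t.1.1.card = d ∧ t.2.1.1.card + t.2.2.1.card = d}.Finite := by
  have hf := finite_diagrams n d
  refine (hf.prod (hf.prod hf)).subset ?_
  rintro ⟨l, μ, ν⟩ ⟨h1, h2⟩
  simp only [Set.mem_prod, Set.mem_ofPred_eq] at *
  omega

/-- The finite set of all triples `(λ, μ, ν)` of Young diagrams with at most `n` rows such that
`|λ| = |μ| + |ν| = d`. -/
noncomputable def triples (n d : ℕ) : Finset (Diagram n × Diagram n × Diagram n) :=
  (finite_triples n d).toFinset

end HiveAlg

namespace HiveAlg

/-! Products of hive monomials are hive monomials, and hive entries are non-negative, so the hive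
algebra has the hive monomials as a basis. Hence its degree `d` part has a basis indexed by the
hives with corner entry `d` (`homogeneousPartBasis`). Telescoping along the sides makes this entry
the sum of the first side, and also the sum of the other two. It remains to see that `c^λ_{μν}`
counts the hives with sides `λ`, `μ`, `ν` (`lrCoeff_eq_card_boundaryHive`).

Tableaux are encoded as Gelfand-Tsetlin patterns: `x k r` counts the entries smaller than `k` in row
`r`. Bender-Knuth involutions show that Schur polynomials are symmetric, so with `ρ_k = n - 1 - k`
the product `a_{μ+ρ} s^ν` is the sum of the alternants `a_{μ+ρ+wt x}` over all patterns `x` of top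
row `ν`. Following Stembridge, the patterns for which `μ` plus the weight of the columns from some
`J` on fails to be dominant cancel in pairs: at the first failure, counted from the right, a
Bender-Knuth involution is applied to the columns left of it (`alternant_mul_schurPoly_eq_good`).
For `μ = 0` a single pattern survives, which is the bialternant formula. For general `μ`, division
by `a_ρ` gives the Littlewood-Richardson rule, and the coefficients of `x^{λ+ρ}` give uniqueness.

Finally, goodness by columns is equivalent to goodness by rows. Reading the row increments of a hive
as the levels of a pattern, two families of rhombus inequalities are the interlacing conditions and
the remaining one is row goodness. Thus good patterns of weight `λ - μ` are the hives with sides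
`λ`, `μ`, `ν` (`lrHive_bijective`). -/

/-! ### Gelfand-Tsetlin patterns -/

/-- Gelfand-Tsetlin patterns with `n` levels and top row `ν`, extended by the zero row below and by
constant rows above: `x k r` is the `r`-th entry of level `k`. -/
structure IsGT (n : ℕ) (ν : ℕ → ℕ) (x : ℕ → ℕ → ℕ) : Prop where
  zero : ∀ r, x 0 r = 0
  mono : ∀ k r, x k r ≤ x (k + 1) r
  inter : ∀ k r, x (k + 1) (r + 1) ≤ x k r
  top : ∀ k r, n ≤ k → x k r = ν r

namespace IsGT

variable {n : ℕ} {ν ν' : ℕ → ℕ} {x y : ℕ → ℕ → ℕ}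

theorem monotone (hx : IsGT n ν x) (r : ℕ) : Monotone fun k => x k r :=
  monotone_nat_of_le_succ fun k => hx.mono k r

theorem antitone (hx : IsGT n ν x) (k : ℕ) : Antitone (x k) :=
  antitone_nat_of_succ_le fun r => (hx.mono k (r + 1)).trans (hx.inter k r)

theorem eq_zero (hx : IsGT n ν x) : ∀ k r, k ≤ r → x k r = 0
  | 0, r, _ => hx.zero r
  | k + 1, 0, h => by omega
  | k + 1, r + 1, h => by
    have h1 := hx.eq_zero k r (by omega)
    have h2 := hx.inter k r
    omega

theorem le_top (hx : IsGT n ν x) (k r : ℕ) : x k r ≤ ν r := by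
  rw [← hx.top (max k n) r (le_max_right _ _)]
  exact hx.monotone r (le_max_left _ _)

theorem eq_zero_of_le (hx : IsGT n ν x) (k r : ℕ) (h : n ≤ r) : x k r = 0 := by
  have h1 := hx.le_top k r
  have h2 := hx.eq_zero n r h
  rw [hx.top n r le_rfl] at h2
  omega

theorem add (hx : IsGT n ν x) (hy : IsGT n ν' y) :
    IsGT n (fun r => ν r + ν' r) fun k r => x k r + y k r where
  zero r := by simp [hx.zero, hy.zero]
  mono k r := add_le_add (hx.mono k r) (hy.mono k r)
  inter k r := add_le_add (hx.inter k r) (hy.inter k r)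
  top k r h := by simp [hx.top k r h, hy.top k r h]

/-- With columns numbered from 0, this keeps the columns before `J` of the tableau; `shift` keeps
the columns from `J` on. The two patterns add up to `x`. -/
theorem truncate (hx : IsGT n ν x) (J : ℕ) :
    IsGT n (fun r => min (ν r) J) fun k r => min (x k r) J where
  zero r := by simp [hx.zero]
  mono k r := min_le_min_right J (hx.mono k r)
  inter k r := min_le_min_right J (hx.inter k r)
  top k r h := by simp [hx.top k r h]

theorem shift (hx : IsGT n ν x) (J : ℕ) : IsGT n (fun r => ν r - J) fun k r => x k r - J where
  zero r := by simp [hx.zero]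
  mono k r := Nat.sub_le_sub_right (hx.mono k r) J
  inter k r := Nat.sub_le_sub_right (hx.inter k r) J
  top k r h := by simp [hx.top k r h]

end IsGT

/-- The sum of the entries of level `k`. -/
def levelSum (n : ℕ) (x : ℕ → ℕ → ℕ) (k : ℕ) : ℕ := ∑ r ∈ Finset.range n, x k r

/-- The weight of a pattern: the number of letters `k` in the corresponding tableau. -/
def weight (n : ℕ) (x : ℕ → ℕ → ℕ) (k : ℕ) : ℕ := ∑ r ∈ Finset.range n, (x (k + 1) r - x k r)

theorem levelSum_add_weight_of_le {x : ℕ → ℕ → ℕ} {k : ℕ} (h : ∀ r, x k r ≤ x (k + 1) r)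
    (m : ℕ) : levelSum m x k + weight m x k = levelSum m x (k + 1) := by
  rw [levelSum, levelSum, weight, ← Finset.sum_add_distrib]
  exact Finset.sum_congr rfl fun r _ => by have := h r; omega

theorem IsGT.levelSum_add_weight {n : ℕ} {ν : ℕ → ℕ} {x : ℕ → ℕ → ℕ} (hx : IsGT n ν x) (k : ℕ) :
    levelSum n x k + weight n x k = levelSum n x (k + 1) :=
  levelSum_add_weight_of_le (hx.mono k) n

theorem IsGT.weight_add {n : ℕ} {ν ν' : ℕ → ℕ} {x y : ℕ → ℕ → ℕ} (hx : IsGT n ν x)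
    (hy : IsGT n ν' y) (k : ℕ) :
    weight n (fun k r => x k r + y k r) k = weight n x k + weight n y k := by
  rw [weight, weight, weight, ← Finset.sum_add_distrib]
  refine Finset.sum_congr rfl fun r _ => ?_
  have h1 := hx.mono k r
  have h2 := hy.mono k r
  omega

theorem IsGT.weight_eq_min_add_sub {n : ℕ} {ν : ℕ → ℕ} {x : ℕ → ℕ → ℕ} (hx : IsGT n ν x)
    (J k : ℕ) : weight n x k =
      weight n (fun k r => min (x k r) J) k + weight n (fun k r => x k r - J) k := by
  rw [← (hx.truncate J).weight_add (hx.shift J)]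
  congr 1
  funext k r
  omega

/-! ### Bender-Knuth involutions -/

/-- The upper bound for the `r`-th entry of level `i + 1` given the two neighbouring levels. -/
def upperBound (i : ℕ) (x : ℕ → ℕ → ℕ) : ℕ → ℕ
  | 0 => x (i + 2) 0
  | r + 1 => min (x (i + 2) (r + 1)) (x i r)

/-- The Bender-Knuth involution, reflecting each entry of level `i + 1` in the interval of its
possible values given the two neighbouring levels. -/
def toggle (i : ℕ) (x : ℕ → ℕ → ℕ) (k r : ℕ) : ℕ :=
  if k = i + 1 then max (x i r) (x (i + 2) (r + 1)) + upperBound i x r - x (i + 1) r else x k r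

theorem toggle_of_ne {i k : ℕ} (x : ℕ → ℕ → ℕ) (h : k ≠ i + 1) (r : ℕ) :
    toggle i x k r = x k r := by simp [toggle, h]

theorem toggle_succ (i : ℕ) (x : ℕ → ℕ → ℕ) (r : ℕ) : toggle i x (i + 1) r =
    max (x i r) (x (i + 2) (r + 1)) + upperBound i x r - x (i + 1) r := by simp [toggle]

theorem upperBound_toggle (i : ℕ) (x : ℕ → ℕ → ℕ) (r : ℕ) :
    upperBound i (toggle i x) r = upperBound i x r := by
  cases r <;> simp [upperBound, toggle]

namespace IsGT

variable {n : ℕ} {ν ν' : ℕ → ℕ} {x y : ℕ → ℕ → ℕ}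

theorem le_upperBound (hx : IsGT n ν x) (i r : ℕ) : x (i + 1) r ≤ upperBound i x r := by
  cases r with
  | zero => exact hx.mono _ _
  | succ r => exact le_min (hx.mono _ _) (hx.inter _ _)

theorem lowerBound_le (hx : IsGT n ν x) (i r : ℕ) :
    max (x i r) (x (i + 2) (r + 1)) ≤ x (i + 1) r :=
  max_le (hx.mono _ _) (hx.inter _ _)

theorem _root_.HiveAlg.upperBound_le (x : ℕ → ℕ → ℕ) (i r : ℕ) : upperBound i x r ≤ x (i + 2) r := by
  cases r with
  | zero => exact le_rfl
  | succ r => exact min_le_left _ _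

theorem reflect (hx : IsGT n ν x) {i : ℕ} (hi : i + 1 < n) : IsGT n ν (toggle i x) where
  zero r := by rw [toggle_of_ne _ (by omega), hx.zero]
  mono k r := by
    have h1 := hx.le_upperBound i r
    have h2 := hx.lowerBound_le i r
    have h3 := upperBound_le x i r
    rcases eq_or_ne k i with rfl | hk
    · rw [toggle_of_ne _ (by omega), toggle_succ]
      omega
    · rcases eq_or_ne k (i + 1) with rfl | hk'
      · rw [toggle_of_ne (k := i + 1 + 1) _ (by omega), toggle_succ]
        change _ ≤ x (i + 2) r
        omega
      · rw [toggle_of_ne _ hk', toggle_of_ne _ (by omega)]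
        exact hx.mono k r
  inter k r := by
    rcases eq_or_ne k i with rfl | hk
    · have h1 := hx.le_upperBound k (r + 1)
      have h2 := hx.lowerBound_le k (r + 1)
      have h3 : upperBound k x (r + 1) ≤ x k r := min_le_right _ _
      rw [toggle_of_ne (k := k) _ (by omega), toggle_succ]
      omega
    · rcases eq_or_ne k (i + 1) with rfl | hk'
      · have h1 := hx.le_upperBound i r
        have h2 := hx.lowerBound_le i r
        rw [toggle_of_ne (k := i + 2) _ (by omega), toggle_succ]
        omega
      · rw [toggle_of_ne _ hk', toggle_of_ne _ (by omega)]
        exact hx.inter k r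
  top k r h := by rw [toggle_of_ne _ (by omega), hx.top k r h]

theorem toggle_toggle (hx : IsGT n ν x) (i : ℕ) :
    toggle i (toggle i x) = x := by
  funext k r
  by_cases hk : k = i + 1
  · subst hk
    have h1 := hx.le_upperBound i r
    have h2 := hx.lowerBound_le i r
    rw [toggle_succ, upperBound_toggle, toggle_succ, toggle_of_ne _ (by omega),
      toggle_of_ne _ (by omega)]
    omega
  · rw [toggle_of_ne _ hk, toggle_of_ne _ hk]

theorem levelSum_toggle (hx : IsGT n ν x) (i : ℕ) :
    levelSum n (toggle i x) (i + 1) + levelSum n x (i + 1) =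
      levelSum n x i + levelSum n x (i + 2) := by
  -- The upper bound at `r + 1` and the lower bound at `r` are the minimum and the maximum of the
  -- same two numbers, so their sum is free of both. The terms outside the sums are what this
  -- pairing leaves over at the end; they vanish at `m = n`.
  have h1 : ∀ m, ∑ r ∈ Finset.range m,
      (toggle i x (i + 1) r + x (i + 1) r) + upperBound i x m =
      ∑ r ∈ Finset.range m, (x i r + x (i + 2) r) + x (i + 2) m := by
    intro m
    induction m with
    | zero => simp [upperBound]
    | succ m ih =>
      rw [Finset.sum_range_succ, Finset.sum_range_succ, toggle_succ]
      have h1 := hx.le_upperBound i m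
      have h2 := hx.lowerBound_le i m
      have h3 : upperBound i x (m + 1) = min (x (i + 2) (m + 1)) (x i m) := rfl
      omega
  have h2 := h1 n
  have h3 := upperBound_le x i n
  rw [hx.eq_zero_of_le (i + 2) n le_rfl] at h2 h3
  simp only [Finset.sum_add_distrib] at h2
  simp only [levelSum]
  omega

/-- Weights are differences of consecutive level sums. Only the sum of level `i + 1` changes, and it
is reflected between its two neighbours, which exchanges the two adjacent differences. -/
theorem weight_toggle (hx : IsGT n ν x) {i : ℕ} (hi : i + 1 < n) (k : ℕ) :
    weight n (toggle i x) k = weight n x (Equiv.swap i (i + 1) k) := by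
  have hy := hx.reflect hi
  have h0 := hx.levelSum_toggle i
  have hne : ∀ k, k ≠ i + 1 → levelSum n (toggle i x) k = levelSum n x k := fun k hk =>
    Finset.sum_congr rfl fun r _ => toggle_of_ne x hk r
  have h1 := hy.levelSum_add_weight k
  by_cases hk : k = i
  · subst hk
    rw [Equiv.swap_apply_left]
    have h2 := hx.levelSum_add_weight k
    have h3 := hx.levelSum_add_weight (k + 1)
    have h4 := hne k (by omega)
    have h5 := hne (k + 2) (by omega)
    rw [show k + 1 + 1 = k + 2 from rfl] at *
    omega
  · by_cases hk' : k = i + 1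
    · subst hk'
      rw [Equiv.swap_apply_right]
      have h2 := hx.levelSum_add_weight i
      have h3 := hx.levelSum_add_weight (i + 1)
      have h4 := hne (i + 1 + 1) (by omega)
      rw [show i + 1 + 1 = i + 2 from rfl] at *
      omega
    · rw [Equiv.swap_apply_of_ne_of_ne hk hk']
      have h2 := hx.levelSum_add_weight k
      have h3 := hne k (by omega)
      have h4 := hne (k + 1) (by omega)
      omega

end IsGT

/-! ### The sign-reversing involution -/

/-- The weight of the part of the pattern to the right of column `J`, added to `μ`, does not
descend at `i`. -/
def AscentAt (n : ℕ) (μ : ℕ → ℕ) (x : ℕ → ℕ → ℕ) (J i : ℕ) : Prop :=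
  i + 1 < n ∧ μ i + weight n (fun k r => x k r - J) i <
    μ (i + 1) + weight n (fun k r => x k r - J) (i + 1)

/-- Adding to `μ` the columns of the tableau from right to left, one stays dominant. -/
def Good (n : ℕ) (μ : ℕ → ℕ) (x : ℕ → ℕ → ℕ) : Prop := ∀ J i, ¬ AscentAt n μ x J i

/-- Apply the Bender-Knuth involution to the first `J` columns only. -/
def leftToggle (J i : ℕ) (x : ℕ → ℕ → ℕ) (k r : ℕ) : ℕ :=
  toggle i (fun k r => min (x k r) J) k r + (x k r - J)

/-- `(J, i)` is the first position, from the right, at which goodness fails. -/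
structure FirstAscent (n : ℕ) (μ : ℕ → ℕ) (x : ℕ → ℕ → ℕ) (J i : ℕ) : Prop where
  ascent : AscentAt n μ x J i
  maximal : ∀ J' i', J < J' → ¬ AscentAt n μ x J' i'
  minimal : ∀ i' < i, ¬ AscentAt n μ x J i'

theorem FirstAscent.unique {n : ℕ} {μ : ℕ → ℕ} {x : ℕ → ℕ → ℕ} {J i J' i' : ℕ}
    (h : FirstAscent n μ x J i) (h' : FirstAscent n μ x J' i') : J = J' ∧ i = i' := by
  have hJ : J = J' := by
    rcases lt_trichotomy J J' with h1 | h1 | h1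
    · exact absurd h'.ascent (h.maximal _ _ h1)
    · exact h1
    · exact absurd h.ascent (h'.maximal _ _ h1)
  subst hJ
  refine ⟨rfl, ?_⟩
  rcases lt_trichotomy i i' with h1 | h1 | h1
  · exact absurd h.ascent (h'.minimal _ h1)
  · exact h1
  · exact absurd h'.ascent (h.minimal _ h1)

theorem exists_firstAscent {n : ℕ} {μ ν : ℕ → ℕ} {x : ℕ → ℕ → ℕ} (hμ : Antitone μ)
    (hx : IsGT n ν x) (h : ¬ Good n μ x) : ∃ p : ℕ × ℕ, FirstAscent n μ x p.1 p.2 := by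
  classical
  have h' : ∃ J i, AscentAt n μ x J i := by
    by_contra hc
    push Not at hc
    exact h hc
  obtain ⟨J₀, i₀, h₀⟩ := h'
  -- Beyond the longest row no columns remain, and `μ` alone is dominant; so a largest `J` with an
  -- ascent exists.
  have hbd : ∀ J, (∃ i, AscentAt n μ x J i) → J ≤ ν 0 := by
    rintro J ⟨i, -, hi⟩
    by_contra hJ
    have hz : (fun k r => x k r - J) = fun _ _ => 0 := by
      funext k r
      have h1 := hx.antitone k (Nat.zero_le r)
      have h2 := hx.le_top k 0
      omega
    rw [hz] at hi
    have : μ (i + 1) ≤ μ i := hμ (Nat.le_succ i)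
    simp only [weight] at hi
    simp at hi
    omega
  set J := Nat.findGreatest (fun J => ∃ i, AscentAt n μ x J i) (ν 0) with hJdef
  have hJ : ∃ i, AscentAt n μ x J i :=
    Nat.findGreatest_spec (P := fun J => ∃ i, AscentAt n μ x J i) (hbd _ ⟨_, h₀⟩) ⟨_, h₀⟩
  refine ⟨(J, Nat.find hJ), Nat.find_spec hJ, fun J' i' hlt hasc => ?_, fun i' hi' =>
    Nat.find_min hJ hi'⟩
  exact Nat.findGreatest_is_greatest hlt (hbd _ ⟨_, hasc⟩) ⟨_, hasc⟩

namespace IsGT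

variable {n : ℕ} {ν μ : ℕ → ℕ} {x : ℕ → ℕ → ℕ}

/-- The height of column `J` of the part of the tableau with letters below `k`. -/
theorem exists_height (hx : IsGT n ν x) (J k : ℕ) : ∃ c, c ≤ n ∧ ∀ r, J < x k r ↔ r < c := by
  classical
  have hex : ∃ c, ¬ J < x k c := ⟨n, by rw [hx.eq_zero_of_le k n le_rfl]; omega⟩
  refine ⟨Nat.find hex, Nat.find_min' hex (by rw [hx.eq_zero_of_le k n le_rfl]; omega),
    fun r => ⟨fun h => ?_, fun h => not_not.1 (Nat.find_min hex h)⟩⟩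
  by_contra hc
  exact Nat.find_spec hex (h.trans_le (hx.antitone k (not_lt.1 hc)))

theorem _root_.HiveAlg.levelSum_sub_succ {J k c : ℕ} (hc : c ≤ n)
    (h : ∀ r, J < x k r ↔ r < c) : levelSum n (fun k r => x k r - J) k =
      levelSum n (fun k r => x k r - (J + 1)) k + c := by
  have h1 : c = ∑ r ∈ Finset.range n, if r < c then 1 else 0 := by
    rw [← Finset.card_filter, Finset.card_eq_of_equiv_fin]
    have : Finset.filter (fun r => r < c) (Finset.range n) = Finset.range c := by
      ext r
      simp only [Finset.mem_filter, Finset.mem_range]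
      omega
    rw [this]
    exact Finset.equivFinOfCardEq (Finset.card_range c)
  conv_rhs => rw [h1]
  rw [levelSum, levelSum, ← Finset.sum_add_distrib]
  refine Finset.sum_congr rfl fun r _ => ?_
  have := h r
  split_ifs <;> omega

/-- A column contains each letter at most once, so passing from `J + 1` to `J` can create an ascent
only if column `J` contains `i + 1` but not `i`, and the ascent is then by exactly one. The absence
of `i` is the last clause. -/
theorem ascent_column (hx : IsGT n ν x) {J i : ℕ} (h : AscentAt n μ x J i)
    (h' : ¬ AscentAt n μ x (J + 1) i) :
    μ i + weight n (fun k r => x k r - J) i + 1 =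
      μ (i + 1) + weight n (fun k r => x k r - J) (i + 1) ∧
    ∀ r, J < x (i + 1) r → J < x i r := by
  obtain ⟨c₀, hc₀, e₀⟩ := hx.exists_height J i
  obtain ⟨c₁, hc₁, e₁⟩ := hx.exists_height J (i + 1)
  obtain ⟨c₂, hc₂, e₂⟩ := hx.exists_height J (i + 2)
  have s₀ := levelSum_sub_succ hc₀ e₀
  have s₁ := levelSum_sub_succ hc₁ e₁
  have s₂ := levelSum_sub_succ hc₂ e₂
  have w₀ := (hx.shift J).levelSum_add_weight i
  have w₁ := (hx.shift J).levelSum_add_weight (i + 1)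
  have v₀ := (hx.shift (J + 1)).levelSum_add_weight i
  have v₁ := (hx.shift (J + 1)).levelSum_add_weight (i + 1)
  have h01 : c₀ ≤ c₁ := by
    by_contra hc
    have h1 := (e₀ c₁).2 (by omega)
    have h2 := (e₁ c₁).1 (h1.trans_le (hx.mono i c₁))
    omega
  have h12 : c₂ ≤ c₁ + 1 := by
    by_contra hc
    have h1 := (e₂ (c₁ + 1)).2 (by omega)
    have h2 := (e₁ c₁).1 (h1.trans_le (hx.inter (i + 1) c₁))
    omega
  obtain ⟨hn, hlt⟩ := h
  have h2 : μ (i + 1) + weight n (fun k r => x k r - (J + 1)) (i + 1) ≤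
      μ i + weight n (fun k r => x k r - (J + 1)) i := by
    by_contra hc
    exact h' ⟨hn, not_le.1 hc⟩
  rw [show i + 1 + 1 = i + 2 from rfl] at *
  refine ⟨by omega, fun r hr => ?_⟩
  have h3 : c₀ = c₁ := by omega
  rw [e₁] at hr
  rw [e₀]
  omega

theorem toggle_min_le (hx : IsGT n ν x) {i : ℕ} (hi : i + 1 < n) (J k r : ℕ) :
    toggle i (fun k r => min (x k r) J) k r ≤ J :=
  (((hx.truncate J).reflect hi).le_top k r).trans (min_le_right _ _)

/-- Rows reaching beyond column `J` still fill all of the first `J` columns after the toggle. Hence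
cutting the glued pattern at `J` recovers the two pieces, which makes `leftToggle` an involution. -/
theorem toggle_min_eq (hx : IsGT n ν x) {J i : ℕ} (hi : i + 1 < n)
    (h : ∀ r, J < x (i + 1) r → J < x i r) {k r : ℕ} (hr : J < x k r) :
    toggle i (fun k r => min (x k r) J) k r = J := by
  by_cases hk : k = i + 1
  · subst hk
    refine le_antisymm (hx.toggle_min_le hi J _ r) ?_
    have h1 := ((hx.truncate J).reflect hi).mono i r
    rw [toggle_of_ne (k := i) _ (by omega)] at h1
    have h2 := h r hr
    omega
  · rw [toggle_of_ne _ hk]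
    omega

theorem leftToggle_sub (hx : IsGT n ν x) {J i : ℕ} (hi : i + 1 < n)
    (h : ∀ r, J < x (i + 1) r → J < x i r) (k r : ℕ) : leftToggle J i x k r - J = x k r - J := by
  have h1 := hx.toggle_min_le hi J k r
  have h2 := fun hr => hx.toggle_min_eq hi h (k := k) (r := r) hr
  by_cases h3 : J < x k r
  · have := h2 h3
    simp only [leftToggle]
    omega
  · simp only [leftToggle]
    omega

theorem leftToggle_min (hx : IsGT n ν x) {J i : ℕ} (hi : i + 1 < n)
    (h : ∀ r, J < x (i + 1) r → J < x i r) (k r : ℕ) : min (leftToggle J i x k r) J =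
      toggle i (fun k r => min (x k r) J) k r := by
  have h1 := hx.toggle_min_le hi J k r
  have h2 := fun hr => hx.toggle_min_eq hi h (k := k) (r := r) hr
  by_cases h3 : J < x k r
  · have := h2 h3
    simp only [leftToggle]
    omega
  · simp only [leftToggle]
    omega

theorem reflectLeft (hx : IsGT n ν x) {i : ℕ} (hi : i + 1 < n) (J : ℕ) :
    IsGT n ν (leftToggle J i x) := by
  have := ((hx.truncate J).reflect hi).add (hx.shift J)
  have hν : (fun r => min (ν r) J + (ν r - J)) = ν := by
    funext r
    omega
  rwa [hν] at this

theorem leftToggle_leftToggle (hx : IsGT n ν x) {J i : ℕ} (hi : i + 1 < n)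
    (h : ∀ r, J < x (i + 1) r → J < x i r) :
    leftToggle J i (leftToggle J i x) = x := by
  funext k r
  rw [leftToggle, hx.leftToggle_sub hi h,
    show (fun k r => min (leftToggle J i x k r) J) =
      toggle i (fun k r => min (x k r) J) from
      funext fun k => funext fun r => hx.leftToggle_min hi h k r, (hx.truncate J).toggle_toggle]
  dsimp only
  omega

theorem ascentAt_leftToggle (hx : IsGT n ν x) {J i : ℕ} (hi : i + 1 < n)
    (h : ∀ r, J < x (i + 1) r → J < x i r) {J' : ℕ} (hJ : J ≤ J') (i' : ℕ) :
    AscentAt n μ (leftToggle J i x) J' i' ↔ AscentAt n μ x J' i' := by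
  have h1 : (fun k r => leftToggle J i x k r - J') = fun k r => x k r - J' := by
    funext k r
    have := hx.leftToggle_sub hi h k r
    omega
  rw [AscentAt, AscentAt, h1]

theorem firstAscent_column (hx : IsGT n ν x) {J i : ℕ} (h : FirstAscent n μ x J i) :
    μ i + weight n (fun k r => x k r - J) i + 1 =
      μ (i + 1) + weight n (fun k r => x k r - J) (i + 1) ∧
    ∀ r, J < x (i + 1) r → J < x i r :=
  hx.ascent_column h.ascent (h.maximal _ _ (Nat.lt_succ_self J))

theorem firstAscent_leftToggle (hx : IsGT n ν x) {J i : ℕ} (h : FirstAscent n μ x J i) :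
    FirstAscent n μ (leftToggle J i x) J i := by
  have hi := h.ascent.1
  have hc := (hx.firstAscent_column h).2
  refine ⟨(hx.ascentAt_leftToggle hi hc le_rfl i).2 h.ascent, fun J' i' hlt => ?_,
    fun i' hlt => ?_⟩
  · rw [hx.ascentAt_leftToggle hi hc hlt.le]
    exact h.maximal _ _ hlt
  · rw [hx.ascentAt_leftToggle hi hc le_rfl]
    exact h.minimal _ hlt

/-- `μ + ρ + wt` is reflected by the sign-reversing involution. -/
theorem weight_leftToggle (hx : IsGT n ν x) {J i : ℕ} (h : FirstAscent n μ x J i) (k : ℕ) :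
    μ k + (n - 1 - k) + weight n (leftToggle J i x) k =
      μ (Equiv.swap i (i + 1) k) + (n - 1 - Equiv.swap i (i + 1) k) +
        weight n x (Equiv.swap i (i + 1) k) := by
  have hi := h.ascent.1
  -- By `h1`, adding `ρ` to `μ` plus the weight of the right columns gives equal entries at `i` and
  -- `i + 1`. This part is fixed by the swap, while the weight of the left columns is swapped by the
  -- toggle.
  obtain ⟨h1, hc⟩ := hx.firstAscent_column h
  have h2 : weight n (leftToggle J i x) k =
      weight n (fun k r => min (x k r) J) (Equiv.swap i (i + 1) k) +
        weight n (fun k r => x k r - J) k := by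
    rw [← (hx.truncate J).weight_toggle hi, ← ((hx.truncate J).reflect hi).weight_add (hx.shift J)]
    rfl
  rw [h2, hx.weight_eq_min_add_sub J (Equiv.swap i (i + 1) k)]
  by_cases hk1 : k = i
  · subst hk1
    rw [Equiv.swap_apply_left]
    omega
  · by_cases hk2 : k = i + 1
    · subst hk2
      rw [Equiv.swap_apply_right]
      omega
    · rw [Equiv.swap_apply_of_ne_of_ne hk1 hk2]

end IsGT

/-- Gelfand-Tsetlin patterns as a type. -/
abbrev GTPattern (n : ℕ) (ν : ℕ → ℕ) : Type := {x : ℕ → ℕ → ℕ // IsGT n ν x}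

/-! ### Semistandard tableaux and Gelfand-Tsetlin patterns -/

/-- The number of entries smaller than `k` in row `r` of a tableau. -/
def ssytLevels {κ : YoungDiagram} (T : SemistandardYoungTableau κ) (k r : ℕ) : ℕ :=
  ((Finset.range (κ.rowLen r)).filter fun c => T r c < k).card

theorem card_filter_range_of_antitone {N : ℕ} {p : ℕ → Prop} [DecidablePred p]
    (hp : ∀ a b, a ≤ b → b < N → p b → p a) {c : ℕ} (hc : c < N) :
    c < ((Finset.range N).filter p).card ↔ p c := by
  constructor
  · intro h
    by_contra hpc
    have h1 : (Finset.range N).filter p ⊆ Finset.range c := by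
      intro a ha
      simp only [Finset.mem_filter, Finset.mem_range] at ha ⊢
      by_contra hac
      exact hpc (hp c a (by omega) ha.1 ha.2)
    have h2 := Finset.card_le_card h1
    rw [Finset.card_range] at h2
    omega
  · intro h
    have h1 : Finset.range (c + 1) ⊆ (Finset.range N).filter p := by
      intro a ha
      simp only [Finset.mem_filter, Finset.mem_range] at ha ⊢
      exact ⟨by omega, hp a c (by omega) hc h⟩
    have h2 := Finset.card_le_card h1
    rw [Finset.card_range] at h2
    omega

theorem ssytLevels_le {κ : YoungDiagram} (T : SemistandardYoungTableau κ) (k r : ℕ) :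
    ssytLevels T k r ≤ κ.rowLen r :=
  (Finset.card_filter_le _ _).trans (Finset.card_range _).le

theorem lt_ssytLevels_iff {κ : YoungDiagram} (T : SemistandardYoungTableau κ) {k r c : ℕ} :
    c < ssytLevels T k r ↔ c < κ.rowLen r ∧ T r c < k := by
  by_cases hc : c < κ.rowLen r
  · rw [ssytLevels, card_filter_range_of_antitone _ hc]
    · simp [hc]
    · intro a b hab hb hTb
      exact (T.row_weak_of_le hab (YoungDiagram.mem_iff_lt_rowLen.2 hb)).trans_lt hTb
  · have := ssytLevels_le T k r
    omega

/-- Column strictness is the second interlacing inequality: an entry below `k + 1` in row `r + 1`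
has an entry below `k` just above it. -/
theorem isGT_ssytLevels {n : ℕ} {κ : YoungDiagram} (T : BoundedSSYT n κ) :
    IsGT n κ.rowLen (ssytLevels T.1) where
  zero r := by simp [ssytLevels]
  mono k r := le_of_forall_lt fun c hc => by
    rw [lt_ssytLevels_iff] at hc ⊢
    omega
  inter k r := le_of_forall_lt fun c hc => by
    rw [lt_ssytLevels_iff] at hc ⊢
    have h1 := T.1.col_strict (show r < r + 1 by omega) (YoungDiagram.mem_iff_lt_rowLen.2 hc.1)
    have h2 := κ.rowLen_anti r (r + 1) (by omega)
    omega
  top k r h := le_antisymm (ssytLevels_le _ _ _) <| le_of_forall_lt fun c hc => by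
    have := T.2 (r, c) ((YoungDiagram.mem_cells _).2 (YoungDiagram.mem_iff_lt_rowLen.2 hc))
    rw [lt_ssytLevels_iff]
    exact ⟨hc, by simp only at this; omega⟩

/-- The entry in row `r` and column `c` of the tableau of a pattern. -/
noncomputable def patternEntry (x : ℕ → ℕ → ℕ) (r c : ℕ) : ℕ := sInf {k | c < x (k + 1) r}

theorem IsGT.patternEntry_lt_iff {n : ℕ} {ν : ℕ → ℕ} {x : ℕ → ℕ → ℕ} (hx : IsGT n ν x)
    {r c k : ℕ} (hc : c < ν r) : patternEntry x r c < k ↔ c < x k r := by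
  have hne : {k | c < x (k + 1) r}.Nonempty :=
    ⟨n, by rw [Set.mem_ofPred_eq, hx.top (n + 1) r (by omega)]; exact hc⟩
  constructor
  · intro h
    have h1 : c < x (patternEntry x r c + 1) r := Nat.sInf_mem hne
    exact h1.trans_le (hx.monotone r h)
  · intro h
    cases k with
    | zero => rw [hx.zero] at h; omega
    | succ k => exact Nat.lt_succ_of_le (Nat.sInf_le h)

/-- The infimum of the empty set is `0`, which agrees with the default value of a tableau outside
its shape. -/
theorem IsGT.patternEntry_eq_zero {n : ℕ} {ν : ℕ → ℕ} {x : ℕ → ℕ → ℕ} (hx : IsGT n ν x)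
    {r c : ℕ} (hc : ν r ≤ c) : patternEntry x r c = 0 := by
  have h : {k | c < x (k + 1) r} = ∅ := by
    ext k
    have := hx.le_top (k + 1) r
    simp only [Set.mem_ofPred_eq, Set.mem_empty_iff_false, iff_false]
    omega
  rw [patternEntry, h, Nat.sInf_empty]

/-- The semistandard tableau of a pattern. -/
noncomputable def ssytOfPattern {n : ℕ} {κ : YoungDiagram} (x : GTPattern n κ.rowLen) :
    BoundedSSYT n κ :=
  ⟨{ entry := patternEntry x.1
     row_weak' := by
      intro i j1 j2 hj hcell
      have h2 : j2 < κ.rowLen i := YoungDiagram.mem_iff_lt_rowLen.1 hcell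
      have h := (x.2.patternEntry_lt_iff h2).1 (Nat.lt_succ_self _)
      exact Nat.lt_succ_iff.1 ((x.2.patternEntry_lt_iff (hj.trans h2)).2 (hj.trans h))
     col_strict' := by
      intro i1 i2 j hi hcell
      have h2 : j < κ.rowLen i2 := YoungDiagram.mem_iff_lt_rowLen.1 hcell
      have h1 : j < κ.rowLen i1 := h2.trans_le (κ.rowLen_anti _ _ hi.le)
      have h := (x.2.patternEntry_lt_iff h2).1 (Nat.lt_succ_self _)
      rw [x.2.patternEntry_lt_iff h1]
      exact h.trans_le ((x.2.antitone _ hi).trans (x.2.inter _ _))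
     zeros' := by
      intro i j hcell
      exact x.2.patternEntry_eq_zero (not_lt.1 fun h => hcell (YoungDiagram.mem_iff_lt_rowLen.2 h)) },
    fun c hc => by
      have h := YoungDiagram.mem_iff_lt_rowLen.1 ((YoungDiagram.mem_cells _).1 hc)
      refine (x.2.patternEntry_lt_iff h).2 ?_
      rw [x.2.top n _ le_rfl]
      exact h⟩

theorem ssytOfPattern_apply {n : ℕ} {κ : YoungDiagram} (x : GTPattern n κ.rowLen) (r c : ℕ) :
    (ssytOfPattern x).1 r c = patternEntry x.1 r c := rfl

/-- Semistandard tableaux correspond to Gelfand-Tsetlin patterns. -/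
noncomputable def ssytEquiv (n : ℕ) (κ : YoungDiagram) :
    BoundedSSYT n κ ≃ GTPattern n κ.rowLen where
  toFun T := ⟨ssytLevels T.1, isGT_ssytLevels T⟩
  invFun := ssytOfPattern
  left_inv T := by
    refine Subtype.ext (SemistandardYoungTableau.ext fun r c => ?_)
    rw [ssytOfPattern_apply]
    by_cases hc : c < κ.rowLen r
    · refine eq_of_forall_gt_iff fun k => ?_
      rw [(isGT_ssytLevels T).patternEntry_lt_iff hc, lt_ssytLevels_iff]
      simp [hc]
    · rw [(isGT_ssytLevels T).patternEntry_eq_zero (not_lt.1 hc), T.1.zeros]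
      rwa [YoungDiagram.mem_iff_lt_rowLen]
  right_inv x := by
    refine Subtype.ext (funext fun k => funext fun r => eq_of_forall_lt_iff fun c => ?_)
    rw [lt_ssytLevels_iff, ssytOfPattern_apply]
    by_cases hc : c < κ.rowLen r
    · rw [x.2.patternEntry_lt_iff hc]
      simp [hc]
    · have := x.2.le_top k r
      omega

instance (n : ℕ) (κ : YoungDiagram) : Finite (GTPattern n κ.rowLen) :=
  Finite.of_equiv _ (ssytEquiv n κ)

noncomputable instance (n : ℕ) (κ : YoungDiagram) : Fintype (GTPattern n κ.rowLen) :=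
  Fintype.ofFinite _

/-- A finitely supported exponent vector from a sequence of natural numbers. -/
noncomputable def expVec (n : ℕ) (f : ℕ → ℕ) : Fin n →₀ ℕ :=
  Finsupp.equivFunOnFinite.symm fun k => f k

@[simp] theorem expVec_apply (n : ℕ) (f : ℕ → ℕ) (k : Fin n) : expVec n f k = f k := rfl

theorem rowLen_eq_zero {n : ℕ} (κ : Diagram n) {r : ℕ} (h : n ≤ r) : κ.1.rowLen r = 0 := by
  by_contra hc
  have h1 : (r, 0) ∈ κ.1 := YoungDiagram.mem_iff_lt_rowLen.2 (by omega)
  have h2 := YoungDiagram.mem_iff_lt_colLen.1 h1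
  have h3 := κ.2
  omega

theorem sum_cells {n : ℕ} (κ : Diagram n) {M : Type*} [AddCommMonoid M] (f : ℕ × ℕ → M) :
    ∑ c ∈ κ.1.cells, f c =
      ∑ r ∈ Finset.range n, ∑ c ∈ Finset.range (κ.1.rowLen r), f (r, c) := by
  rw [Finset.sum_sigma']
  refine Finset.sum_bij' (fun c _ => ⟨c.1, c.2⟩) (fun c _ => (c.1, c.2)) ?_ ?_ ?_ ?_ ?_
  · rintro ⟨r, c⟩ h
    rw [YoungDiagram.mem_cells, YoungDiagram.mem_iff_lt_rowLen] at h
    simp only [Finset.mem_sigma, Finset.mem_range]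
    refine ⟨?_, h⟩
    by_contra hr
    rw [rowLen_eq_zero κ (not_lt.1 hr)] at h
    omega
  · rintro ⟨r, c⟩ h
    simp only [Finset.mem_sigma, Finset.mem_range] at h
    rw [YoungDiagram.mem_cells, YoungDiagram.mem_iff_lt_rowLen]
    exact h.2
  · intros; rfl
  · intros; rfl
  · intros; rfl

theorem card_eq_sum_rowLen {n : ℕ} (κ : Diagram n) :
    κ.1.card = ∑ r ∈ Finset.range n, κ.1.rowLen r := by
  have := sum_cells κ fun _ => 1
  simpa using this

theorem schurPoly_eq_sum_pattern {n : ℕ} (κ : Diagram n) : schurPoly n κ.1 =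
    ∑ x : GTPattern n κ.1.rowLen, MvPolynomial.monomial (expVec n (weight n x.1)) 1 := by
  rw [schurPoly]
  refine Fintype.sum_equiv (ssytEquiv n κ.1) _ _ fun T => ?_
  have h1 : ∏ c : κ.1.cells, (MvPolynomial.X ⟨T.1 c.1.1 c.1.2, T.2 c.1 c.2⟩ :
      MvPolynomial (Fin n) ℤ) = MvPolynomial.monomial
        (∑ c : κ.1.cells, Finsupp.single ⟨T.1 c.1.1 c.1.2, T.2 c.1 c.2⟩ 1) 1 := by
    rw [MvPolynomial.monomial_sum_one]
    rfl
  rw [h1]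
  refine congrArg (fun e => MvPolynomial.monomial e (1 : ℤ)) (Finsupp.ext fun k => ?_)
  rw [Finsupp.finsetSum_apply, expVec_apply]
  simp only [Finsupp.single_apply, Fin.ext_iff]
  rw [Finset.sum_coe_sort κ.1.cells fun c => if T.1 c.1 c.2 = k then 1 else 0, sum_cells]
  refine Finset.sum_congr rfl fun r _ => ?_
  change _ = ssytLevels T.1 (k + 1) r - ssytLevels T.1 k r
  have h2 : ssytLevels T.1 (k + 1) r = ssytLevels T.1 k r +
      ∑ c ∈ Finset.range (κ.1.rowLen r), if T.1 r c = k then 1 else 0 := by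
    simp only [ssytLevels, Finset.card_filter]
    rw [← Finset.sum_add_distrib]
    refine Finset.sum_congr rfl fun c _ => ?_
    split_ifs <;> omega
  rw [h2, Nat.add_sub_cancel_left]

/-! ### The row form of goodness -/

/-- Adding to `μ` the letters of the tableau row by row, each row from right to left, one stays
dominant. -/
def RowGood (n : ℕ) (μ : ℕ → ℕ) (x : ℕ → ℕ → ℕ) : Prop :=
  ∀ k l, k + 1 < n → μ (k + 1) + weight (l + 1) x (k + 1) ≤ μ k + weight l x k

theorem weight_succ (n : ℕ) (x : ℕ → ℕ → ℕ) (k : ℕ) :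
    weight (n + 1) x k = weight n x k + (x (k + 1) n - x k n) := Finset.sum_range_succ _ _

theorem weight_mono {m n : ℕ} (h : m ≤ n) (x : ℕ → ℕ → ℕ) (k : ℕ) : weight m x k ≤ weight n x k :=
  Finset.sum_le_sum_of_subset (Finset.range_mono h)

theorem weight_eq_of_vanish {m n : ℕ} (h : m ≤ n) {x : ℕ → ℕ → ℕ} {k : ℕ}
    (hx : ∀ r, m ≤ r → x (k + 1) r = 0) : weight n x k = weight m x k := by
  induction n, h using Nat.le_induction with
  | base => rfl
  | succ n hn ih => rw [weight_succ, ih, hx n hn, Nat.zero_sub, add_zero]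

namespace IsGT

variable {n : ℕ} {ν μ : ℕ → ℕ} {x : ℕ → ℕ → ℕ}

theorem weight_eq_of_le (hx : IsGT n ν x) {m : ℕ} (h : n ≤ m) (k : ℕ) :
    weight m x k = weight n x k :=
  weight_eq_of_vanish h fun r hr => hx.eq_zero_of_le _ r hr

/-- Cut at `J = x (k + 1) l`. Every letter `k + 1` in rows up to `l` lies in a column from `J` on,
and every letter `k` in those columns lies in a row before `l`. -/
theorem rowGood_of_good (hx : IsGT n ν x) (h : Good n μ x) : RowGood n μ x := by
  intro k l hk
  set J := x (k + 1) l with hJ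
  have h1 : μ (k + 1) + weight n (fun k r => x k r - J) (k + 1) ≤
      μ k + weight n (fun k r => x k r - J) k := by
    by_contra hc
    exact h J k ⟨hk, not_le.1 hc⟩
  have h2 : weight (l + 1) x (k + 1) ≤ weight n (fun k r => x k r - J) (k + 1) := by
    rw [← (hx.shift J).weight_eq_of_le (Nat.le_add_right n (l + 1))]
    refine le_trans (le_of_eq ?_) (weight_mono (Nat.le_add_left (l + 1) n) _ _)
    refine Finset.sum_congr rfl fun r hr => ?_
    have h3 := hx.antitone (k + 1) (Nat.lt_succ_iff.1 (Finset.mem_range.1 hr))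
    dsimp only
    omega
  have h3 : weight n (fun k r => x k r - J) k ≤ weight l x k := by
    rw [← (hx.shift J).weight_eq_of_le (Nat.le_add_right n l)]
    rw [weight_eq_of_vanish (Nat.le_add_left l n)]
    · exact Finset.sum_le_sum fun r _ => by dsimp only; omega
    · intro r hr
      have h3 := hx.antitone (k + 1) hr
      omega
  omega

/-- Let `p` be the number of rows with an entry at most `k` in column `J`. From column `J` on,
letters `k + 1` occur only in rows up to `p`, and all letters `k` of the first `p - 1` rows are
counted; only row `p - 1` may be cut by `J`. -/
theorem good_of_rowGood (hx : IsGT n ν x) (h : RowGood n μ x) : Good n μ x := by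
  rintro J k ⟨hk, hlt⟩
  obtain ⟨p, hp, hpJ⟩ := hx.exists_height J (k + 1)
  have h1 : weight n (fun k r => x k r - J) (k + 1) ≤ weight p x (k + 1) + (x (k + 2) p - J) := by
    have h2 : weight (p + 1) (fun k r => x k r - J) (k + 1) ≤
        weight p x (k + 1) + (x (k + 2) p - J) := by
      rw [weight_succ]
      refine add_le_add (Finset.sum_le_sum fun r _ => by dsimp only; omega) (Nat.sub_le _ _)
    refine (weight_mono (Nat.le_succ n) _ _).trans ((le_of_eq ?_).trans h2)
    refine weight_eq_of_vanish (by omega) fun r hr => ?_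
    obtain ⟨r, rfl⟩ : ∃ r', r = r' + 1 := ⟨r - 1, by omega⟩
    have h3 := hx.inter (k + 1) r
    have h4 := hpJ r
    omega
  cases p with
  | zero =>
    have h2 := h k 0 hk
    have h3 := hpJ 0
    rw [weight_succ] at h2
    simp only [weight, Finset.range_zero, Finset.sum_empty] at h1 h2
    simp only [weight] at hlt
    rw [show k + 1 + 1 = k + 2 from rfl] at *
    omega
  | succ q =>
    have h2 := weight_mono hp (fun k r => x k r - J) k
    rw [weight_succ] at h2
    have h3 : weight q (fun k r => x k r - J) k = weight q x k := by
      refine Finset.sum_congr rfl fun r hr => ?_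
      have h4 := (hpJ (r + 1)).2 (by have := Finset.mem_range.1 hr; omega)
      have h5 := hx.inter k r
      have h6 := hx.mono k r
      dsimp only
      omega
    have h4 := (hpJ q).2 (Nat.lt_succ_self q)
    have h5 : x (k + 1) (q + 1) ≤ J := not_lt.1 fun h6 => by
      have := (hpJ (q + 1)).1 h6
      omega
    -- If the letters `k` of row `q` all lie from column `J` on, row goodness is used with them.
    -- Otherwise they fill row `q` from `J` to `x (k + 1) q`, which by interlacing outweighs the
    -- letters `k + 1` counted in row `q + 1`, and row goodness is used without either.
    by_cases h6 : J ≤ x k q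
    · have h7 := h k (q + 1) hk
      rw [weight_succ (q + 1), weight_succ q x k] at h7
      rw [show k + 1 + 1 = k + 2 from rfl] at *
      omega
    · have h7 := h k q hk
      have h8 := hx.inter (k + 1) q
      rw [show k + 1 + 1 = k + 2 from rfl] at *
      omega

end IsGT

/-! ### The highest weight pattern -/

/-- The pattern of the tableau whose `r`-th row is filled with `r`. -/
def highestPattern (ν : ℕ → ℕ) (k r : ℕ) : ℕ := if r < k then ν r else 0

section Highest

variable {n : ℕ} {ν : ℕ → ℕ} {x : ℕ → ℕ → ℕ}

theorem isGT_highestPattern (hν : Antitone ν) (h0 : ∀ r, n ≤ r → ν r = 0) :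
    IsGT n ν (highestPattern ν) where
  zero r := by simp [highestPattern]
  mono k r := by
    simp only [highestPattern]
    split_ifs <;> omega
  inter k r := by
    have := hν (Nat.le_add_right r 1)
    simp only [highestPattern]
    split_ifs <;> omega
  top k r h := by
    have := h0 r
    simp only [highestPattern]
    split_ifs <;> omega

theorem weight_highestPattern_sub (J : ℕ) {k : ℕ} (hk : k < n) :
    weight n (fun k r => highestPattern ν k r - J) k = ν k - J := by
  rw [weight, Finset.sum_eq_single k]
  · simp [highestPattern]
  · intro r _ hr
    simp only [highestPattern]
    split_ifs <;> omega
  · intro h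
    exact absurd (Finset.mem_range.2 hk) h

theorem good_highestPattern (hν : Antitone ν) : Good n 0 (highestPattern ν) := by
  rintro J i ⟨hi, hlt⟩
  rw [weight_highestPattern_sub J (by omega), weight_highestPattern_sub J hi] at hlt
  have := hν (Nat.le_add_right i 1)
  simp only [Pi.zero_apply] at hlt
  omega

theorem IsGT.eq_highestPattern (hx : IsGT n ν x) (h : Good n 0 x) : x = highestPattern ν := by
  have hrow := hx.rowGood_of_good h
  -- For `μ = 0`, row goodness excludes the letter `k + 1` from row `l` unless `k` occurs in an
  -- earlier row; inductively no letter occurs above the row of its own number.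
  have h1 : ∀ k l, k < n → l ≤ k → weight l x k = 0 := by
    intro k
    induction k with
    | zero =>
      intro l _ hl
      rw [Nat.le_zero.1 hl]
      rfl
    | succ k ih =>
      intro l hk hl
      cases l with
      | zero => rfl
      | succ l =>
        have h2 := hrow k l hk
        have h3 := ih l (by omega) (by omega)
        simp only [Pi.zero_apply] at h2
        omega
  have h2 : ∀ k r, k < n → r < k → x (k + 1) r = x k r := by
    intro k r hk hr
    have h3 := h1 k (r + 1) hk hr
    rw [weight_succ] at h3
    have h4 := hx.mono k r
    omega
  have h3 : ∀ d k r, k + d = n → r < k → x k r = ν r := by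
    intro d
    induction d with
    | zero => exact fun k r hk _ => hx.top k r (by omega)
    | succ d ih =>
      intro k r hk hr
      rw [← h2 k r (by omega) hr]
      exact ih (k + 1) r (by omega) (by omega)
  funext k r
  rw [highestPattern]
  split_ifs with hr
  · by_cases hk : k ≤ n
    · exact h3 (n - k) k r (by omega) hr
    · exact hx.top k r (by omega)
  · exact hx.eq_zero k r (not_lt.1 hr)

end Highest

/-! ### Alternants -/

open MvPolynomial in
/-- Antisymmetrization of polynomials. -/
noncomputable def antisymmetrize (n : ℕ) : MvPolynomial (Fin n) ℤ →ₗ[ℤ] MvPolynomial (Fin n) ℤ :=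
  ∑ σ : Equiv.Perm (Fin n), (Equiv.Perm.sign σ : ℤ) • (rename σ).toLinearMap

/-- The alternant of an exponent vector. -/
noncomputable def alternant (n : ℕ) (f : ℕ → ℕ) : MvPolynomial (Fin n) ℤ :=
  antisymmetrize n (MvPolynomial.monomial (expVec n f) 1)

theorem antisymmetrize_apply (n : ℕ) (p : MvPolynomial (Fin n) ℤ) : antisymmetrize n p =
    ∑ σ : Equiv.Perm (Fin n), (Equiv.Perm.sign σ : ℤ) • MvPolynomial.rename σ p := by
  simp [antisymmetrize]

theorem antisymmetrize_rename {n : ℕ} (τ : Equiv.Perm (Fin n)) (p : MvPolynomial (Fin n) ℤ) :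
    antisymmetrize n (MvPolynomial.rename τ p) =
      (Equiv.Perm.sign τ : ℤ) • antisymmetrize n p := by
  rw [antisymmetrize_apply, antisymmetrize_apply, Finset.smul_sum]
  refine Fintype.sum_equiv (Equiv.mulRight τ) _ _ fun σ => ?_
  rw [Equiv.coe_mulRight, MvPolynomial.rename_rename, smul_smul, Equiv.Perm.sign_mul,
    Equiv.Perm.coe_mul]
  congr 1
  rw [Units.val_mul, mul_comm (Equiv.Perm.sign σ : ℤ), ← mul_assoc, ← Units.val_mul,
    Int.units_mul_self, Units.val_one, one_mul]

theorem antisymmetrize_mul_of_isSymmetric {n : ℕ} (p : MvPolynomial (Fin n) ℤ)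
    {q : MvPolynomial (Fin n) ℤ} (hq : q.IsSymmetric) :
    antisymmetrize n (p * q) = antisymmetrize n p * q := by
  rw [antisymmetrize_apply, antisymmetrize_apply, Finset.sum_mul]
  refine Finset.sum_congr rfl fun σ _ => ?_
  rw [map_mul, hq σ, smul_mul_assoc]

theorem rename_monomial_expVec {n : ℕ} {i : ℕ} (hi : i + 1 < n) {f g : ℕ → ℕ}
    (h : ∀ k < n, g k = f (Equiv.swap i (i + 1) k)) :
    MvPolynomial.rename (Equiv.swap (⟨i, by omega⟩ : Fin n) ⟨i + 1, hi⟩)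
      (MvPolynomial.monomial (expVec n f) (1 : ℤ)) = MvPolynomial.monomial (expVec n g) 1 := by
  rw [MvPolynomial.rename_monomial]
  refine congrArg (fun e => MvPolynomial.monomial e (1 : ℤ)) (Finsupp.ext fun k => ?_)
  rw [Finsupp.mapDomain_equiv_apply, Equiv.symm_swap, expVec_apply, expVec_apply, h k k.2]
  congr 1
  simp only [Equiv.swap_apply_def, Fin.ext_iff]
  split_ifs <;> rfl

theorem alternant_swap {n : ℕ} {i : ℕ} (hi : i + 1 < n) {f g : ℕ → ℕ}
    (h : ∀ k < n, g k = f (Equiv.swap i (i + 1) k)) : alternant n g = - alternant n f := by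
  rw [alternant, alternant, ← rename_monomial_expVec hi h, antisymmetrize_rename,
    Equiv.Perm.sign_swap (by simp [Fin.ext_iff])]
  simp

/-- An adjacent transposition symmetry criterion. -/
theorem isSymmetric_of_adjacent {n : ℕ} {p : MvPolynomial (Fin n) ℤ}
    (h : ∀ i (hi : i + 1 < n),
      MvPolynomial.rename (Equiv.swap (⟨i, by omega⟩ : Fin n) ⟨i + 1, hi⟩) p = p) :
    p.IsSymmetric := by
  cases n with
  | zero =>
    intro σ
    rw [Subsingleton.elim σ 1]
    exact MvPolynomial.rename_id_apply p
  | succ n =>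
    intro σ
    have hσ : σ ∈ Submonoid.closure
        (Set.range fun i : Fin n => Equiv.swap i.castSucc i.succ) := by
      rw [Equiv.Perm.mclosure_swap_castSucc_succ]
      trivial
    induction hσ using Submonoid.closure_induction with
    | mem τ hτ =>
      obtain ⟨i, rfl⟩ := hτ
      exact h i (by omega)
    | one => exact MvPolynomial.rename_id_apply p
    | mul σ τ _ _ hσ hτ =>
      rw [Equiv.Perm.coe_mul, ← MvPolynomial.rename_rename, hτ, hσ]

/-- The Bender-Knuth involution on patterns. -/
def togglePerm {n : ℕ} (ν : ℕ → ℕ) {i : ℕ} (hi : i + 1 < n) : Equiv.Perm (GTPattern n ν) :=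
  Function.Involutive.toPerm (fun x => ⟨toggle i x.1, x.2.reflect hi⟩) fun x =>
    Subtype.ext (x.2.toggle_toggle i)

/-- Adjacent transpositions suffice, and each is realized on weights by a Bender-Knuth permutation
of the patterns. -/
theorem schurPoly_isSymmetric {n : ℕ} (κ : Diagram n) : (schurPoly n κ.1).IsSymmetric := by
  refine isSymmetric_of_adjacent fun i hi => ?_
  rw [schurPoly_eq_sum_pattern, map_sum]
  refine Fintype.sum_equiv (togglePerm _ hi) _ _ fun x => ?_
  exact rename_monomial_expVec hi fun k _ => x.2.weight_toggle hi k

theorem monomial_expVec_mul {n : ℕ} (f g : ℕ → ℕ) :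
    MvPolynomial.monomial (expVec n f) (1 : ℤ) * MvPolynomial.monomial (expVec n g) 1 =
      MvPolynomial.monomial (expVec n fun k => f k + g k) 1 := by
  rw [MvPolynomial.monomial_mul, one_mul]
  exact congrArg (fun e => MvPolynomial.monomial e (1 : ℤ)) (Finsupp.ext fun _ => rfl)

theorem alternant_mul_schurPoly {n : ℕ} (f : ℕ → ℕ) (κ : Diagram n) :
    alternant n f * schurPoly n κ.1 =
      ∑ x : GTPattern n κ.1.rowLen, alternant n fun k => f k + weight n x.1 k := by
  rw [alternant, ← antisymmetrize_mul_of_isSymmetric _ (schurPoly_isSymmetric κ),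
    schurPoly_eq_sum_pattern, Finset.mul_sum, map_sum]
  refine Finset.sum_congr rfl fun x _ => ?_
  rw [monomial_expVec_mul, alternant]

-- Bad patterns cancel: `leftToggle` at the first ascent acts on `μ + ρ + wt` as an adjacent
-- transposition, which negates the alternant. It keeps the first ascent, hence is an involution on
-- bad patterns.
open Classical in
theorem alternant_mul_schurPoly_eq_good {n : ℕ} {μ : ℕ → ℕ} (hμ : Antitone μ) (κ : Diagram n) :
    alternant n (fun k => μ k + (n - 1 - k)) * schurPoly n κ.1 =
      ∑ x : GTPattern n κ.1.rowLen with Good n μ x.1,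
        alternant n fun k => μ k + (n - 1 - k) + weight n x.1 k := by
  rw [alternant_mul_schurPoly, ← Finset.sum_filter_add_sum_filter_not _
    fun x : GTPattern n κ.1.rowLen => Good n μ x.1]
  refine add_eq_left.2 ?_
  have key : ∀ x : GTPattern n κ.1.rowLen, ∃ y : GTPattern n κ.1.rowLen, ¬ Good n μ x.1 →
      ∃ J i, FirstAscent n μ x.1 J i ∧ y.1 = leftToggle J i x.1 := by
    intro x
    by_cases hx : Good n μ x.1
    · exact ⟨x, fun h => absurd hx h⟩
    · obtain ⟨⟨J, i⟩, hJ⟩ := exists_firstAscent hμ x.2 hx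
      exact ⟨⟨_, x.2.reflectLeft hJ.ascent.1 J⟩, fun _ => ⟨J, i, hJ, rfl⟩⟩
  choose φ hφ using key
  have hneg : ∀ x : GTPattern n κ.1.rowLen, ¬ Good n μ x.1 →
      (alternant n fun k => μ k + (n - 1 - k) + weight n x.1 k) +
        (alternant n fun k => μ k + (n - 1 - k) + weight n (φ x).1 k) = 0 := by
    intro x hx
    obtain ⟨J, i, hJ, hy⟩ := hφ x hx
    rw [alternant_swap hJ.ascent.1 (g := fun k => μ k + (n - 1 - k) + weight n (φ x).1 k)
      (f := fun k => μ k + (n - 1 - k) + weight n x.1 k)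
      fun k _ => by rw [hy]; exact x.2.weight_leftToggle hJ k, add_neg_cancel]
  have hbad : ∀ x : GTPattern n κ.1.rowLen, ¬ Good n μ x.1 →
      ∃ J i, FirstAscent n μ x.1 J i ∧ FirstAscent n μ (φ x).1 J i := by
    intro x hx
    obtain ⟨J, i, hJ, hy⟩ := hφ x hx
    exact ⟨J, i, hJ, hy ▸ x.2.firstAscent_leftToggle hJ⟩
  have hmem : ∀ x : GTPattern n κ.1.rowLen, ¬ Good n μ x.1 → ¬ Good n μ (φ x).1 := by
    intro x hx hgood
    obtain ⟨J, i, -, hJ⟩ := hbad x hx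
    exact hgood J i hJ.ascent
  refine Finset.sum_involution (fun x _ => φ x) ?_ ?_ ?_ ?_
  · intro x hx
    exact hneg x (Finset.mem_filter.1 hx).2
  -- Fixed points may occur, but there the alternant is its own negative, hence zero.
  · intro x hx hne heq
    have h1 := hneg x (Finset.mem_filter.1 hx).2
    rw [heq, ← two_mul] at h1
    exact hne ((mul_eq_zero.1 h1).resolve_left two_ne_zero)
  · intro x hx
    simpa using hmem x (Finset.mem_filter.1 hx).2
  · intro x hx
    have hx := (Finset.mem_filter.1 hx).2
    obtain ⟨J, i, hJ, hy⟩ := hφ x hx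
    obtain ⟨J', i', hJ', hy'⟩ := hφ (φ x) (hmem x hx)
    obtain ⟨rfl, rfl⟩ := FirstAscent.unique hJ' (hy ▸ x.2.firstAscent_leftToggle hJ)
    refine Subtype.ext ?_
    rw [hy', hy]
    exact x.2.leftToggle_leftToggle hJ.ascent.1 (x.2.firstAscent_column hJ).2

/-- The bialternant formula. -/
theorem alternant_rho_mul_schurPoly {n : ℕ} (κ : Diagram n) :
    alternant n (fun k => n - 1 - k) * schurPoly n κ.1 =
      alternant n fun k => κ.1.rowLen k + (n - 1 - k) := by
  classical
  have hν : Antitone κ.1.rowLen := fun a b h => κ.1.rowLen_anti a b h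
  have h0 : ∀ r, n ≤ r → κ.1.rowLen r = 0 := fun r => rowLen_eq_zero κ
  have h := alternant_mul_schurPoly_eq_good (n := n) (μ := 0) (fun _ _ _ => le_rfl) κ
  simp only [Pi.zero_apply, zero_add] at h
  rw [h, Finset.sum_eq_single_of_mem ⟨highestPattern κ.1.rowLen, isGT_highestPattern hν h0⟩]
  · rw [alternant, alternant]
    refine congrArg (fun e => antisymmetrize n (MvPolynomial.monomial e 1)) (Finsupp.ext fun k => ?_)
    have := weight_highestPattern_sub (ν := κ.1.rowLen) 0 k.2
    simp only [Nat.sub_zero] at this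
    rw [expVec_apply, expVec_apply]
    change _ + weight n (fun k r => highestPattern κ.1.rowLen k r) k = _
    rw [this, add_comm]
  · simpa using good_highestPattern hν
  · intro x hx hne
    exact absurd (Subtype.ext (x.2.eq_highestPattern (Finset.mem_filter.1 hx).2)) hne

/-- Only the identity permutation carries one strictly decreasing exponent sequence to another, so
the terms of the other permutations contribute nothing. -/
theorem coeff_alternant {n : ℕ} {f g : ℕ → ℕ} (hf : ∀ a b, a < b → b < n → f b < f a)
    (hg : ∀ a b, a < b → b < n → g b < g a) :
    MvPolynomial.coeff (expVec n f) (alternant n g) =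
      if expVec n f = expVec n g then 1 else 0 := by
  classical
  rw [alternant, antisymmetrize_apply, MvPolynomial.coeff_sum, Finset.sum_eq_single 1]
  · rw [MvPolynomial.coeff_smul, Equiv.Perm.coe_one, MvPolynomial.rename_id_apply,
      MvPolynomial.coeff_monomial]
    simp [eq_comm]
  · intro σ _ hσ
    rw [MvPolynomial.coeff_smul, MvPolynomial.rename_monomial, MvPolynomial.coeff_monomial,
      if_neg, smul_zero]
    intro he
    apply hσ
    have h1 : ∀ k, g (σ.symm k : Fin n) = f k := fun k => by
      have := DFunLike.congr_fun he k
      rwa [Finsupp.mapDomain_equiv_apply] at this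
    have h2 : StrictMono σ.symm := by
      intro a b hab
      have h3 := hf a b hab b.2
      rw [← h1, ← h1] at h3
      by_contra hc
      rcases (not_lt.1 hc).lt_or_eq with h4 | h4
      · have := hg _ _ h4 (σ.symm a).2
        omega
      · rw [h4] at h3
        omega
    have h3 : (σ.symm : Fin n → Fin n) = id := by
      refine (StrictMono.range_inj h2 strictMono_id).1 ?_
      rw [σ.symm.surjective.range_eq, Set.range_id]
    ext k
    have h4 := congrFun h3 (σ k)
    rw [Equiv.symm_apply_apply] at h4
    exact congrArg Fin.val h4.symm
  · intro h
    exact absurd (Finset.mem_univ _) h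

theorem alternant_rho_ne_zero (n : ℕ) : alternant n (fun k => n - 1 - k) ≠ 0 := by
  have hf : ∀ a b, a < b → b < n → n - 1 - b < n - 1 - a := fun a b _ _ => by omega
  intro h
  have := coeff_alternant hf hf
  rw [h] at this
  simp at this

/-! ### Young diagrams from row lengths -/

theorem rowLen_antitone {n : ℕ} (κ : Diagram n) : Antitone κ.1.rowLen :=
  fun a b h => κ.1.rowLen_anti a b h

/-- The Young diagram with given row lengths. -/
def diagramOfRows (n : ℕ) (f : ℕ → ℕ) (hf : Antitone f) : Diagram n :=
  ⟨{ cells := (Finset.range n ×ˢ Finset.range (f 0)).filter fun c => c.2 < f c.1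
     isLowerSet := by
      rintro ⟨r, c⟩ ⟨r', c'⟩ ⟨hr, hc⟩ h
      simp only [Finset.coe_filter, Finset.mem_product, Finset.mem_range,
        Set.mem_ofPred_eq] at h hr hc ⊢
      have h1 := hf hr
      omega },
    by
      by_contra hc
      have h1 := YoungDiagram.mem_iff_lt_colLen.2 (not_le.1 hc)
      rw [← YoungDiagram.mem_cells] at h1
      simp at h1⟩

theorem rowLen_diagramOfRows {n : ℕ} {f : ℕ → ℕ} (hf : Antitone f) (h0 : ∀ r, n ≤ r → f r = 0) :
    (diagramOfRows n f hf).1.rowLen = f := by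
  refine funext fun r => eq_of_forall_lt_iff fun c => ?_
  rw [← YoungDiagram.mem_iff_lt_rowLen, ← YoungDiagram.mem_cells]
  simp only [diagramOfRows, Finset.mem_filter, Finset.mem_product, Finset.mem_range]
  have h1 := hf (Nat.zero_le r)
  have h2 := h0 r
  omega

theorem diagram_ext {n : ℕ} {κ κ' : Diagram n} (h : ∀ k < n, κ.1.rowLen k = κ'.1.rowLen k) :
    κ = κ' := by
  refine Subtype.ext (YoungDiagram.ext (Finset.ext fun ⟨r, c⟩ => ?_))
  rw [YoungDiagram.mem_cells, YoungDiagram.mem_cells, YoungDiagram.mem_iff_lt_rowLen,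
    YoungDiagram.mem_iff_lt_rowLen]
  by_cases hr : r < n
  · rw [h r hr]
  · rw [rowLen_eq_zero κ (not_lt.1 hr), rowLen_eq_zero κ' (not_lt.1 hr)]

/-! ### The Littlewood-Richardson rule for patterns -/

theorem IsGT.weight_eq_zero {n : ℕ} {ν : ℕ → ℕ} {x : ℕ → ℕ → ℕ} (hx : IsGT n ν x) {k : ℕ}
    (h : n ≤ k) : weight n x k = 0 :=
  Finset.sum_eq_zero fun r _ => by
    rw [hx.top k r h, hx.top (k + 1) r (by omega), Nat.sub_self]

theorem IsGT.antitone_add_weight {n : ℕ} {ν : ℕ → ℕ} {x : ℕ → ℕ → ℕ} (hx : IsGT n ν x)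
    (μ : Diagram n) (h : Good n μ.1.rowLen x) :
    Antitone fun k => μ.1.rowLen k + weight n x k := by
  refine antitone_nat_of_succ_le fun k => ?_
  by_cases hk : k + 1 < n
  · by_contra hc
    exact h 0 k ⟨hk, not_le.1 hc⟩
  · rw [rowLen_eq_zero μ (not_lt.1 hk), hx.weight_eq_zero (not_lt.1 hk)]
    exact Nat.zero_le _

/-- For a bad pattern the diagram is an arbitrary value; `goodMultiplicity` sums over good patterns
only. -/
theorem exists_goodShape {n : ℕ} (μ ν : Diagram n) (x : GTPattern n ν.1.rowLen) :
    ∃ l : Diagram n, Good n μ.1.rowLen x.1 →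
      l.1.rowLen = fun k => μ.1.rowLen k + weight n x.1 k := by
  by_cases h : Good n μ.1.rowLen x.1
  · exact ⟨diagramOfRows n _ (x.2.antitone_add_weight μ h), fun _ =>
      rowLen_diagramOfRows _ fun r hr => by rw [rowLen_eq_zero μ hr, x.2.weight_eq_zero hr]⟩
  · exact ⟨μ, fun h' => absurd h' h⟩

/-- The Young diagram with row lengths `μ + wt x`, for a good pattern `x`. -/
noncomputable def goodShape {n : ℕ} (μ ν : Diagram n) (x : GTPattern n ν.1.rowLen) : Diagram n :=
  (exists_goodShape μ ν x).choose

theorem rowLen_goodShape {n : ℕ} {μ ν : Diagram n} {x : GTPattern n ν.1.rowLen}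
    (h : Good n μ.1.rowLen x.1) :
    (goodShape μ ν x).1.rowLen = fun k => μ.1.rowLen k + weight n x.1 k :=
  (exists_goodShape μ ν x).choose_spec h

open Classical in
/-- The multiplicities of the Littlewood-Richardson rule. -/
noncomputable def goodMultiplicity {n : ℕ} (μ ν : Diagram n) : Diagram n →₀ ℕ :=
  ∑ x : GTPattern n ν.1.rowLen with Good n μ.1.rowLen x.1, Finsupp.single (goodShape μ ν x) 1

theorem isSchurDecomposition_goodMultiplicity {n : ℕ} (μ ν : Diagram n) :
    IsSchurDecomposition μ ν (goodMultiplicity μ ν) := by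
  classical
  have h1 : ((goodMultiplicity μ ν).sum fun l m => m • schurPoly n l.1) =
      ∑ x : GTPattern n ν.1.rowLen with Good n μ.1.rowLen x.1,
        schurPoly n (goodShape μ ν x).1 := by
    change Finsupp.linearCombination ℕ (fun l : Diagram n => schurPoly n l.1) _ = _
    rw [goodMultiplicity, map_sum]
    simp
  rw [IsSchurDecomposition, h1]
  refine mul_left_cancel₀ (alternant_rho_ne_zero n) ?_
  rw [← mul_assoc, alternant_rho_mul_schurPoly,
    alternant_mul_schurPoly_eq_good (rowLen_antitone μ), Finset.mul_sum]
  refine Finset.sum_congr rfl fun x hx => ?_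
  rw [alternant_rho_mul_schurPoly, rowLen_goodShape (Finset.mem_filter.1 hx).2]
  exact congrArg (alternant n) (funext fun k => Nat.add_right_comm _ _ _)

/-- Multiplication by `a_ρ` turns the Schur polynomials into alternants with distinct leading
monomials, from which each multiplicity can be read off. This gives uniqueness of the decomposition.
-/
theorem coeff_alternant_rho_mul_sum {n : ℕ} (c : Diagram n →₀ ℕ) (l : Diagram n) :
    MvPolynomial.coeff (expVec n fun k => l.1.rowLen k + (n - 1 - k))
      (alternant n (fun k => n - 1 - k) * c.sum fun l m => m • schurPoly n l.1) = c l := by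
  classical
  have hanti : ∀ l : Diagram n, ∀ a b, a < b → b < n →
      l.1.rowLen b + (n - 1 - b) < l.1.rowLen a + (n - 1 - a) := fun l a b hab hb => by
    have := rowLen_antitone l hab.le
    omega
  have hiff : ∀ l' : Diagram n, (expVec n fun k => l.1.rowLen k + (n - 1 - k)) =
      (expVec n fun k => l'.1.rowLen k + (n - 1 - k)) ↔ l = l' := fun l' => by
    refine ⟨fun h => diagram_ext fun k hk => ?_, fun h => by rw [h]⟩
    have := DFunLike.congr_fun h ⟨k, hk⟩
    simp only [expVec_apply] at this
    omega
  rw [Finsupp.sum, Finset.mul_sum, MvPolynomial.coeff_sum]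
  have h1 : ∀ l' ∈ c.support, MvPolynomial.coeff (expVec n fun k => l.1.rowLen k + (n - 1 - k))
      (alternant n (fun k => n - 1 - k) * c l' • schurPoly n l'.1) =
        if l = l' then (c l' : ℤ) else 0 := fun l' _ => by
    rw [mul_smul_comm, alternant_rho_mul_schurPoly, MvPolynomial.coeff_smul,
      coeff_alternant (hanti l) (hanti l')]
    simp [hiff]
  rw [Finset.sum_congr rfl h1, Finset.sum_ite_eq]
  split_ifs with h
  · rfl
  · rw [Finsupp.notMem_support_iff.1 h, Nat.cast_zero]

theorem IsSchurDecomposition.unique {n : ℕ} {μ ν : Diagram n} {c c' : Diagram n →₀ ℕ}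
    (h : IsSchurDecomposition μ ν c) (h' : IsSchurDecomposition μ ν c') : c = c' := by
  ext l
  have h1 := coeff_alternant_rho_mul_sum c l
  rw [← show _ = c.sum _ from h, show _ = c'.sum _ from h', coeff_alternant_rho_mul_sum] at h1
  exact_mod_cast h1.symm

/-- Good patterns of top row `ν` whose weight is `l - μ`. -/
abbrev LRPattern {n : ℕ} (l μ ν : Diagram n) : Type :=
  {x : GTPattern n ν.1.rowLen // Good n μ.1.rowLen x.1 ∧
    ∀ k < n, μ.1.rowLen k + weight n x.1 k = l.1.rowLen k}

theorem lrCoeff_eq_card {n : ℕ} (l μ ν : Diagram n) :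
    lrCoeff l μ ν = Nat.card (LRPattern l μ ν) := by
  classical
  have h1 : Classical.epsilon (IsSchurDecomposition μ ν) = goodMultiplicity μ ν :=
    (Classical.epsilon_spec ⟨_, isSchurDecomposition_goodMultiplicity μ ν⟩).unique
      (isSchurDecomposition_goodMultiplicity μ ν)
  rw [lrCoeff, h1, goodMultiplicity, Finsupp.finsetSum_apply]
  simp only [Finsupp.single_apply]
  rw [← Finset.card_filter, Finset.filter_filter, Nat.card_eq_fintype_card,
    Fintype.card_subtype]
  congr 1
  refine Finset.filter_congr fun x _ => and_congr_right fun hx => ?_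
  refine ⟨fun h k _ => ?_, fun h => diagram_ext fun k hk => ?_⟩
  · rw [← h, rowLen_goodShape hx]
  · rw [rowLen_goodShape hx]
    exact h k hk

/-! ### Hives and patterns -/

/-- The hive of a pattern and a sequence `μ`: its left side has increments `μ` and its rows have
the increments prescribed by the levels of the pattern. -/
def hiveOfPattern (n : ℕ) (μ : ℕ → ℕ) (x : ℕ → ℕ → ℕ) (p : Idx n) : ℤ :=
  ((∑ k ∈ Finset.range (p.1.1 - 1), μ k + levelSum (p.1.2 - 1) x (p.1.1 - 1) : ℕ) : ℤ)

theorem mem_triangle {n i j : ℕ} (hi : i ≤ n) (hj : j ≤ i) :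
    (i + 1, j + 1) ∈ (Finset.Icc 1 (n + 1) ×ˢ Finset.Icc 1 (n + 1)).filter
      fun p : ℕ × ℕ => p.2 ≤ p.1 := by
  simp only [Finset.mem_filter, Finset.mem_product, Finset.mem_Icc]
  omega

theorem entry_hiveOfPattern {n : ℕ} (μ : ℕ → ℕ) (x : ℕ → ℕ → ℕ) {i j : ℕ} (hi : i ≤ n)
    (hj : j ≤ i) : entry (hiveOfPattern n μ x) (i + 1) (j + 1) =
      ((∑ k ∈ Finset.range i, μ k + levelSum j x i : ℕ) : ℤ) := by
  rw [entry, dif_pos (mem_triangle hi hj)]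
  rfl

theorem idx_ext {n : ℕ} {h h' : Idx n → ℤ}
    (heq : ∀ i j, i ≤ n → j ≤ i → entry h (i + 1) (j + 1) = entry h' (i + 1) (j + 1)) : h = h' := by
  funext ⟨⟨i, j⟩, hp⟩
  have hp' := hp
  simp only [Finset.mem_filter, Finset.mem_product, Finset.mem_Icc] at hp'
  have h1 := heq (i - 1) (j - 1) (by omega) (by omega)
  rw [show i - 1 + 1 = i by omega, show j - 1 + 1 = j by omega] at h1
  rwa [entry, dif_pos hp, entry, dif_pos hp] at h1

theorem levelSum_succ (m : ℕ) (x : ℕ → ℕ → ℕ) (k : ℕ) :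
    levelSum (m + 1) x k = levelSum m x k + x k m := Finset.sum_range_succ _ _

theorem levelSum_zero (x : ℕ → ℕ → ℕ) (k : ℕ) : levelSum 0 x k = 0 := rfl

namespace IsGT

variable {n : ℕ} {ν μ : ℕ → ℕ} {x : ℕ → ℕ → ℕ}

theorem levelSum_eq_of_le (hx : IsGT n ν x) {k m : ℕ} (h : k ≤ m) :
    levelSum m x k = levelSum k x k := by
  induction m, h using Nat.le_induction with
  | base => rfl
  | succ m hm ih => rw [levelSum_succ, ih, hx.eq_zero k m hm, add_zero]

theorem boundaryA_hiveOfPattern (hx : IsGT n ν x) (k : Fin n) :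
    boundaryA (hiveOfPattern n μ x) k = ((μ k + weight n x k : ℕ) : ℤ) := by
  rw [boundaryA, show (k : ℕ) + 2 = k + 1 + 1 from rfl, entry_hiveOfPattern _ _ k.2 le_rfl,
    entry_hiveOfPattern _ _ k.2.le le_rfl, Finset.sum_range_succ,
    ← hx.levelSum_eq_of_le (show (k : ℕ) + 1 ≤ n from k.2), ← hx.levelSum_eq_of_le k.2.le,
    ← hx.levelSum_add_weight]
  push_cast
  ring

theorem _root_.HiveAlg.boundaryB_hiveOfPattern (μ : ℕ → ℕ) (x : ℕ → ℕ → ℕ) (k : Fin n) :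
    boundaryB (hiveOfPattern n μ x) k = μ k := by
  have h1 := entry_hiveOfPattern (n := n) μ x k.2 (Nat.zero_le _)
  have h2 := entry_hiveOfPattern (n := n) μ x k.2.le (Nat.zero_le _)
  rw [zero_add] at h1 h2
  rw [boundaryB, h2, show (k : ℕ) + 2 = k + 1 + 1 from rfl, h1, Finset.sum_range_succ,
    levelSum_zero, levelSum_zero]
  push_cast
  ring

theorem boundaryC_hiveOfPattern (hx : IsGT n ν x) (k : Fin n) :
    boundaryC (hiveOfPattern n μ x) k = ν k := by
  rw [boundaryC, show (k : ℕ) + 2 = k + 1 + 1 from rfl, entry_hiveOfPattern _ _ le_rfl k.2,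
    entry_hiveOfPattern _ _ le_rfl k.2.le, levelSum_succ, hx.top n k le_rfl]
  push_cast
  ring

/-- The first and third rhombus inequalities are the two interlacing conditions, the second is row
goodness, and the sides are `μ + wt x`, `μ` and `ν`. -/
theorem isHive_hiveOfPattern (hx : IsGT n ν x) (hμ : Antitone μ) (h : RowGood n μ x)
    (hA : Antitone fun k => μ k + weight n x k) : IsHive (hiveOfPattern n μ x) where
  apex := by
    have := entry_hiveOfPattern (n := n) μ x (Nat.zero_le _) (le_refl 0)
    rw [zero_add] at this
    rw [this]
    rfl
  rhombus₁ i j h1 h2 h3 := by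
    obtain ⟨l, rfl⟩ : ∃ l, j = l + 1 := ⟨j - 1, by omega⟩
    obtain ⟨k, rfl⟩ : ∃ k, i = k + 1 := ⟨i - 1, by omega⟩
    rw [entry_hiveOfPattern μ x (by omega) (by omega), entry_hiveOfPattern μ x (by omega) (by omega),
      entry_hiveOfPattern μ x (by omega) (by omega), entry_hiveOfPattern μ x (by omega) (by omega),
      levelSum_succ, levelSum_succ]
    have := hx.mono k l
    omega
  rhombus₂ i j h1 h2 h3 := by
    obtain ⟨l, rfl⟩ : ∃ l, j = l + 1 := ⟨j - 1, by omega⟩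
    obtain ⟨k, rfl⟩ : ∃ k, i = k + 2 := ⟨i - 2, by omega⟩
    rw [show k + 2 - 1 = k + 1 by omega, show k + 2 = k + 1 + 1 from rfl,
      entry_hiveOfPattern μ x (by omega) (by omega), entry_hiveOfPattern μ x (by omega) (by omega),
      entry_hiveOfPattern μ x (by omega) (by omega), entry_hiveOfPattern μ x (by omega) (by omega),
      Finset.sum_range_succ μ (k + 1), Finset.sum_range_succ μ k,
      ← levelSum_add_weight_of_le (hx.mono (k + 1)) (l + 1),
      ← levelSum_add_weight_of_le (hx.mono k) l]
    have := h k l (by omega)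
    omega
  rhombus₃ i j h1 h2 h3 := by
    obtain ⟨l, rfl⟩ : ∃ l, j = l + 2 := ⟨j - 2, by omega⟩
    obtain ⟨k, rfl⟩ : ∃ k, i = k + 1 := ⟨i - 1, by omega⟩
    rw [show l + 2 - 1 = l + 1 by omega, show l + 2 = l + 1 + 1 from rfl,
      entry_hiveOfPattern μ x (by omega) (by omega), entry_hiveOfPattern μ x (by omega) (by omega),
      entry_hiveOfPattern μ x (by omega) (by omega), entry_hiveOfPattern μ x (by omega) (by omega),
      levelSum_succ (l + 1) x (k + 1), levelSum_succ l x k]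
    have := hx.inter k l
    omega
  domA := by
    refine ⟨fun a b hab => ?_, fun a => ?_⟩
    · rw [hx.boundaryA_hiveOfPattern, hx.boundaryA_hiveOfPattern]
      exact_mod_cast hA (show (a : ℕ) ≤ b from hab)
    · rw [hx.boundaryA_hiveOfPattern]
      exact Int.natCast_nonneg _
  domB := by
    refine ⟨fun a b hab => ?_, fun a => ?_⟩
    · rw [boundaryB_hiveOfPattern, boundaryB_hiveOfPattern]
      exact_mod_cast hμ (show (a : ℕ) ≤ b from hab)
    · rw [boundaryB_hiveOfPattern]
      exact Int.natCast_nonneg _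
  domC := by
    refine ⟨fun a b hab => ?_, fun a => ?_⟩
    · rw [hx.boundaryC_hiveOfPattern, hx.boundaryC_hiveOfPattern]
      rw [← hx.top n a le_rfl, ← hx.top n b le_rfl]
      exact_mod_cast hx.antitone n (show (a : ℕ) ≤ b from hab)
    · rw [hx.boundaryC_hiveOfPattern]
      exact Int.natCast_nonneg _

/-- Row goodness has to be checked only inside the triangle. -/
theorem rowGood_of_triangle (hx : IsGT n ν x) (h : ∀ k l, k + 1 < n → l ≤ k →
    μ (k + 1) + weight (l + 1) x (k + 1) ≤ μ k + weight l x k) : RowGood n μ x := by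
  intro k l hk
  by_cases hl : l ≤ k
  · exact h k l hk hl
  · rw [weight_eq_of_vanish (show k + 1 ≤ l by omega) fun r hr => hx.eq_zero _ r hr,
      weight_eq_of_vanish (show k + 2 ≤ l + 1 by omega) fun r hr => hx.eq_zero _ r hr,
      weight_succ (k + 1) x (k + 1), weight_succ k x k, hx.eq_zero (k + 1) (k + 1) le_rfl, hx.eq_zero k k le_rfl]
    -- Beyond the triangle both sides are constant in `l`. Compared with `l = k` they gain `x (k +
    -- 2) (k + 1)` and `x (k + 1) k`, which interlace.
    have h1 := h k k hk le_rfl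
    have h2 := hx.inter (k + 1) k
    omega

end IsGT

/-! ### From hives to patterns -/

/-- The increments of row `k + 1` of an array. -/
def rowStep {n : ℕ} (h : Idx n → ℤ) (k r : ℕ) : ℤ :=
  entry h (k + 1) (r + 2) - entry h (k + 1) (r + 1)

namespace IsHive

variable {n : ℕ} {h : Idx n → ℤ} {ν μ : ℕ → ℕ}

theorem rowStep_mono (hh : IsHive h) {k r : ℕ} (hr : r < k) (hk : k + 1 ≤ n) :
    rowStep h k r ≤ rowStep h (k + 1) r := by
  obtain ⟨k, rfl⟩ : ∃ k', k = k' + 1 := ⟨k - 1, by omega⟩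
  have := hh.rhombus₁ (k + 2) (r + 1) (by omega) (by omega) (by omega)
  simp only [rowStep]
  linarith

theorem rowStep_inter (hh : IsHive h) {k r : ℕ} (hr : r < k) (hk : k + 1 ≤ n) :
    rowStep h (k + 1) (r + 1) ≤ rowStep h k r := by
  have := hh.rhombus₃ (k + 1) (r + 2) (by omega) (by omega) (by omega)
  rw [show r + 2 - 1 = r + 1 by omega] at this
  simp only [rowStep]
  linarith

/-- The last increment of each row dominates that of the next row, down to the bottom side, where it
is non-negative; the other increments follow because they grow down the rows. -/
theorem rowStep_nonneg (hh : IsHive h) : ∀ {k r : ℕ}, r < k → k ≤ n → 0 ≤ rowStep h k r := by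
  have hdiag : ∀ d r, r + 1 + d = n → 0 ≤ rowStep h (r + 1) r := by
    intro d
    induction d with
    | zero =>
      intro r hr
      have h1 := hh.domC.2 ⟨r, by omega⟩
      rw [boundaryC] at h1
      rw [show r + 1 = n by omega]
      exact h1
    | succ d ih =>
      intro r hr
      exact (ih (r + 1) (by omega)).trans (hh.rowStep_inter (by omega) (by omega))
  intro k r hr
  induction k, hr using Nat.le_induction with
  | base => exact fun hk => hdiag (n - (r + 1)) r (by simp only [Nat.succ_eq_add_one] at hk; omega)
  | succ k hk ih => exact fun hk' => (ih (by omega)).trans (hh.rowStep_mono (by omega) hk')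

end IsHive

/-- The pattern of a hive with third boundary side `ν`. -/
def patternOfHive {n : ℕ} (ν : ℕ → ℕ) (h : Idx n → ℤ) (k r : ℕ) : ℕ :=
  if n ≤ k then ν r else if r < k then (rowStep h k r).toNat else 0

section PatternOfHive

variable {n : ℕ} {h : Idx n → ℤ} {ν μ : ℕ → ℕ}

theorem patternOfHive_eq_rowStep (hh : IsHive h) (hC : ∀ k : Fin n, boundaryC h k = ν k) {k r : ℕ}
    (hr : r < k) (hk : k ≤ n) : (patternOfHive ν h k r : ℤ) = rowStep h k r := by
  rcases hk.lt_or_eq with hk' | rfl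
  · rw [patternOfHive, if_neg (by omega), if_pos hr, Int.toNat_of_nonneg (hh.rowStep_nonneg hr hk)]
  · rw [patternOfHive, if_pos le_rfl, ← hC ⟨r, hr⟩]
    rfl

theorem patternOfHive_eq_zero (h0 : ∀ r, n ≤ r → ν r = 0) {k r : ℕ} (hr : k ≤ r) (hk : k ≤ n) :
    patternOfHive ν h k r = 0 := by
  rw [patternOfHive]
  split_ifs
  · exact h0 r (by omega)
  · omega
  · rfl

theorem isGT_patternOfHive (hh : IsHive h) (hC : ∀ k : Fin n, boundaryC h k = ν k)
    (hν : Antitone ν) (h0 : ∀ r, n ≤ r → ν r = 0) : IsGT n ν (patternOfHive ν h) where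
  zero r := patternOfHive_eq_zero h0 (Nat.zero_le r) (Nat.zero_le n)
  mono k r := by
    by_cases hk : n ≤ k
    · rw [patternOfHive, if_pos hk, patternOfHive, if_pos (by omega)]
    · by_cases hr : r < k
      · have h1 := hh.rowStep_mono hr (by omega)
        rw [← patternOfHive_eq_rowStep hh hC hr (by omega),
          ← patternOfHive_eq_rowStep hh hC (by omega) (by omega)] at h1
        exact_mod_cast h1
      · rw [patternOfHive_eq_zero h0 (not_lt.1 hr) (by omega)]
        exact Nat.zero_le _
  inter k r := by
    by_cases hk : n ≤ k
    · rw [patternOfHive, if_pos (by omega), patternOfHive, if_pos hk]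
      exact hν (Nat.le_succ r)
    · by_cases hr : r < k
      · have h1 := hh.rowStep_inter hr (by omega)
        rw [← patternOfHive_eq_rowStep hh hC hr (by omega),
          ← patternOfHive_eq_rowStep hh hC (by omega) (by omega)] at h1
        exact_mod_cast h1
      · rw [patternOfHive_eq_zero h0 (by omega) (by omega)]
        exact Nat.zero_le _
  top k r hk := if_pos hk

theorem hiveOfPattern_patternOfHive (hh : IsHive h) (hB : ∀ k : Fin n, boundaryB h k = μ k)
    (hC : ∀ k : Fin n, boundaryC h k = ν k) : hiveOfPattern n μ (patternOfHive ν h) = h := by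
  refine idx_ext fun i j hi hj => ?_
  rw [entry_hiveOfPattern μ _ hi hj]
  induction j with
  | zero =>
    clear hj
    rw [levelSum_zero, add_zero]
    induction i with
    | zero => simp [hh.apex]
    | succ i ih =>
      have h1 := hB ⟨i, hi⟩
      simp only [boundaryB] at h1
      have h2 := ih (by omega)
      rw [zero_add] at h2 ⊢
      rw [Finset.sum_range_succ, Nat.cast_add, h2, ← h1]
      ring_nf
  | succ j ih =>
    rw [levelSum_succ, ← add_assoc, Nat.cast_add, ih (by omega),
      patternOfHive_eq_rowStep hh hC hj hi, rowStep]
    ring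

theorem rowGood_patternOfHive (hh : IsHive h) (hB : ∀ k : Fin n, boundaryB h k = μ k)
    (hC : ∀ k : Fin n, boundaryC h k = ν k) (hν : Antitone ν) (h0 : ∀ r, n ≤ r → ν r = 0) :
    RowGood n μ (patternOfHive ν h) := by
  have hx := isGT_patternOfHive hh hC hν h0
  refine hx.rowGood_of_triangle fun k l hk hl => ?_
  have h1 := hh.rhombus₂ (k + 2) (l + 1) (by omega) (by omega) (by omega)
  rw [← hiveOfPattern_patternOfHive hh hB hC, show k + 2 - 1 = k + 1 by omega,
    show k + 2 = k + 1 + 1 from rfl,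
    entry_hiveOfPattern _ _ (by omega) (by omega), entry_hiveOfPattern _ _ (by omega) (by omega),
    entry_hiveOfPattern _ _ (by omega) (by omega), entry_hiveOfPattern _ _ (by omega) (by omega),
    Finset.sum_range_succ μ (k + 1), Finset.sum_range_succ μ k,
    ← levelSum_add_weight_of_le (hx.mono (k + 1)) (l + 1),
    ← levelSum_add_weight_of_le (hx.mono k) l] at h1
  omega

end PatternOfHive

/-- Hives with prescribed boundary sides. -/
abbrev BoundaryHive {n : ℕ} (l μ ν : Diagram n) : Type :=
  {h : Idx n → ℤ // IsHive h ∧ (∀ k, boundaryA h k = l.1.rowLen k) ∧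
    (∀ k, boundaryB h k = μ.1.rowLen k) ∧ ∀ k, boundaryC h k = ν.1.rowLen k}

/-- The hive of a Littlewood-Richardson pattern. -/
def lrHive {n : ℕ} {l μ ν : Diagram n} (x : LRPattern l μ ν) : BoundaryHive l μ ν :=
  ⟨hiveOfPattern n μ.1.rowLen x.1.1,
    x.1.2.isHive_hiveOfPattern (rowLen_antitone μ) (x.1.2.rowGood_of_good x.2.1)
      (x.1.2.antitone_add_weight μ x.2.1),
    fun k => by rw [x.1.2.boundaryA_hiveOfPattern, x.2.2 k k.2],
    fun k => boundaryB_hiveOfPattern _ _ k, fun k => x.1.2.boundaryC_hiveOfPattern k⟩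

theorem lrHive_bijective {n : ℕ} (l μ ν : Diagram n) :
    Function.Bijective (lrHive : LRPattern l μ ν → BoundaryHive l μ ν) := by
  constructor
  · intro x y hxy
    have h1 : hiveOfPattern n μ.1.rowLen x.1.1 = hiveOfPattern n μ.1.rowLen y.1.1 :=
      congrArg Subtype.val hxy
    refine Subtype.ext (Subtype.ext (funext fun k => funext fun r => ?_))
    by_cases hk : n ≤ k
    · rw [x.1.2.top k r hk, y.1.2.top k r hk]
    · by_cases hr : r < k
      · have h2 := entry_hiveOfPattern μ.1.rowLen x.1.1 (not_le.1 hk).le hr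
        have h3 := entry_hiveOfPattern μ.1.rowLen x.1.1 (not_le.1 hk).le hr.le
        rw [h1, entry_hiveOfPattern _ _ (not_le.1 hk).le hr, levelSum_succ, levelSum_succ] at h2
        rw [h1, entry_hiveOfPattern _ _ (not_le.1 hk).le hr.le] at h3
        omega
      · rw [x.1.2.eq_zero k r (not_lt.1 hr), y.1.2.eq_zero k r (not_lt.1 hr)]
  · rintro ⟨h, hh, hA, hB, hC⟩
    have h0 : ∀ r, n ≤ r → ν.1.rowLen r = 0 := fun r => rowLen_eq_zero ν
    have hx := isGT_patternOfHive hh hC (rowLen_antitone ν) h0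
    have heq := hiveOfPattern_patternOfHive hh hB hC
    refine ⟨⟨⟨_, hx⟩, hx.good_of_rowGood (rowGood_patternOfHive hh hB hC (rowLen_antitone ν) h0),
      fun k hk => ?_⟩, Subtype.ext heq⟩
    -- The weight condition comes from the first side, which is `μ + wt` for the reconstructed hive.
    have h1 := hx.boundaryA_hiveOfPattern (μ := μ.1.rowLen) ⟨k, hk⟩
    rw [heq, hA] at h1
    exact_mod_cast h1.symm

theorem lrCoeff_eq_card_boundaryHive {n : ℕ} (l μ ν : Diagram n) :
    lrCoeff l μ ν = Nat.card (BoundaryHive l μ ν) := by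
  rw [lrCoeff_eq_card]
  exact Nat.card_congr (Equiv.ofBijective _ (lrHive_bijective l μ ν))

instance {n : ℕ} (l μ ν : Diagram n) : Finite (BoundaryHive l μ ν) :=
  Finite.of_equiv _ (Equiv.ofBijective _ (lrHive_bijective l μ ν))

/-! ### Counting hives by their corner entry -/

/-- Hives with corner entry `d`. -/
abbrev CornerHive (n d : ℕ) : Type := {h : Idx n → ℤ // IsHive h ∧ h (corner n) = d}

theorem entry_corner {n : ℕ} (h : Idx n → ℤ) : entry h (n + 1) (n + 1) = h (corner n) :=
  dif_pos (corner n).2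

theorem IsHive.corner_eq_sum_boundaryA {n : ℕ} {h : Idx n → ℤ} (hh : IsHive h) :
    h (corner n) = ∑ k, boundaryA h k := by
  rw [← entry_corner h]
  change _ = ∑ k : Fin n, (entry h (k + 1 + 1) (k + 1 + 1) - entry h (k + 1) (k + 1))
  rw [Fin.sum_univ_eq_sum_range
      (fun k => entry h (k + 1 + 1) (k + 1 + 1) - entry h (k + 1) (k + 1)) n,
    Finset.sum_range_sub (fun k => entry h (k + 1) (k + 1)), zero_add, hh.apex, sub_zero]

/-- Telescope from the apex down the left side, then along the bottom. With the path down the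
diagonal this yields `|λ| = |μ| + |ν|`. -/
theorem IsHive.corner_eq_sum_boundaryB_add {n : ℕ} {h : Idx n → ℤ} (hh : IsHive h) :
    h (corner n) = ∑ k, boundaryB h k + ∑ k, boundaryC h k := by
  have hB : ∑ k, boundaryB h k = entry h (n + 1) 1 := by
    change ∑ k : Fin n, (entry h (k + 1 + 1) 1 - entry h (k + 1) 1) = _
    rw [Fin.sum_univ_eq_sum_range (fun k => entry h (k + 1 + 1) 1 - entry h (k + 1) 1) n,
      Finset.sum_range_sub (fun k => entry h (k + 1) 1), zero_add, hh.apex, sub_zero]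
  have hC : ∑ k, boundaryC h k = entry h (n + 1) (n + 1) - entry h (n + 1) 1 := by
    change ∑ k : Fin n, (entry h (n + 1) (k + 1 + 1) - entry h (n + 1) (k + 1)) = _
    rw [Fin.sum_univ_eq_sum_range (fun k => entry h (n + 1) (k + 1 + 1) - entry h (n + 1) (k + 1)) n,
      Finset.sum_range_sub (fun k => entry h (n + 1) (k + 1)), zero_add]
  rw [hB, hC, entry_corner]
  ring

theorem sum_eq_card_of_rowLen {n : ℕ} {κ : Diagram n} {a : Fin n → ℤ}
    (h : ∀ k, a k = κ.1.rowLen k) : ∑ k, a k = κ.1.card := by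
  rw [card_eq_sum_rowLen, ← Fin.sum_univ_eq_sum_range (fun k => κ.1.rowLen k) n, Nat.cast_sum]
  exact Finset.sum_congr rfl fun k _ => h k

theorem NonnegDominant.exists_diagram {n : ℕ} {a : Fin n → ℤ} (ha : NonnegDominant a) :
    ∃ κ : Diagram n, ∀ k, a k = κ.1.rowLen k := by
  let f : ℕ → ℕ := fun k => if hk : k < n then (a ⟨k, hk⟩).toNat else 0
  have hf : Antitone f := by
    intro i j hij
    by_cases hj : j < n
    · simp only [f, dif_pos hj, dif_pos (hij.trans_lt hj)]
      exact Int.toNat_le_toNat (ha.1 hij)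
    · simp only [f, dif_neg hj]
      exact Nat.zero_le _
  refine ⟨diagramOfRows n f hf, fun k => ?_⟩
  rw [rowLen_diagramOfRows hf fun r hr => dif_neg (not_lt.2 hr)]
  simp only [f, dif_pos k.2]
  exact (Int.toNat_of_nonneg (ha.2 k)).symm

theorem mem_triples {n d : ℕ} (t : Diagram n × Diagram n × Diagram n) :
    t ∈ triples n d ↔ t.1.1.card = d ∧ t.2.1.1.card + t.2.2.1.card = d :=
  Set.Finite.mem_toFinset _

/-- A hive with boundary of size `d` has corner entry `d`. -/
def cornerHiveOfBoundary (n d : ℕ) (s : Σ t : triples n d, BoundaryHive t.1.1 t.1.2.1 t.1.2.2) :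
    CornerHive n d :=
  ⟨s.2.1, s.2.2.1, by
    rw [s.2.2.1.corner_eq_sum_boundaryA, sum_eq_card_of_rowLen s.2.2.2.1,
      ((mem_triples _).1 s.1.2).1]⟩

theorem diagram_eq_of_boundary {n : ℕ} {κ κ' : Diagram n} {a : Fin n → ℤ}
    (h : ∀ k, a k = κ.1.rowLen k) (h' : ∀ k, a k = κ'.1.rowLen k) : κ = κ' :=
  diagram_ext fun k hk => by exact_mod_cast (h ⟨k, hk⟩).symm.trans (h' ⟨k, hk⟩)

theorem cornerHiveOfBoundary_bijective (n d : ℕ) :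
    Function.Bijective (cornerHiveOfBoundary n d) := by
  constructor
  · rintro ⟨⟨⟨l, μ, ν⟩, ht⟩, ⟨h, hh, hA, hB, hC⟩⟩ ⟨⟨⟨l', μ', ν'⟩, ht'⟩, ⟨h', hh', hA', hB', hC'⟩⟩ heq
    obtain rfl : h = h' := congrArg Subtype.val heq
    obtain rfl := diagram_eq_of_boundary hA hA'
    obtain rfl := diagram_eq_of_boundary hB hB'
    obtain rfl := diagram_eq_of_boundary hC hC'
    rfl
  · rintro ⟨h, hh, hd⟩
    obtain ⟨l, hA⟩ := hh.domA.exists_diagram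
    obtain ⟨μ, hB⟩ := hh.domB.exists_diagram
    obtain ⟨ν, hC⟩ := hh.domC.exists_diagram
    have h1 := hh.corner_eq_sum_boundaryA
    have h2 := hh.corner_eq_sum_boundaryB_add
    rw [hd, sum_eq_card_of_rowLen hA] at h1
    rw [hd, sum_eq_card_of_rowLen hB, sum_eq_card_of_rowLen hC] at h2
    exact ⟨⟨⟨(l, μ, ν), (mem_triples _).2 ⟨by exact_mod_cast h1.symm, by exact_mod_cast h2.symm⟩⟩,
      ⟨h, hh, hA, hB, hC⟩⟩, rfl⟩

instance (n d : ℕ) : Finite (CornerHive n d) :=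
  Finite.of_equiv _ (Equiv.ofBijective _ (cornerHiveOfBoundary_bijective n d))

theorem card_cornerHive (n d : ℕ) :
    Nat.card (CornerHive n d) = ∑ t ∈ triples n d, lrCoeff t.1 t.2.1 t.2.2 := by
  rw [← Nat.card_congr (Equiv.ofBijective _ (cornerHiveOfBoundary_bijective n d)), Nat.card_sigma,
    ← Finset.sum_coe_sort (triples n d)]
  exact Finset.sum_congr rfl fun t _ => (lrCoeff_eq_card_boundaryHive _ _ _).symm

/-! ### The homogeneous parts of the hive algebra -/

/-- The exponent vector of the monomial of an array. -/
noncomputable def hiveExponent {n : ℕ} (h : Idx n → ℤ) : Idx n →₀ ℕ :=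
  Finsupp.equivFunOnFinite.symm fun p => (h p).toNat

theorem hiveMonomial_eq_monomial {n : ℕ} (h : Idx n → ℤ) :
    hiveMonomial h = MvPolynomial.monomial (hiveExponent h) 1 := by
  rw [MvPolynomial.monomial_eq, MvPolynomial.C_1, one_mul,
    Finsupp.prod_fintype _ _ fun _ => pow_zero _]
  rfl

theorem hiveExponent_injOn (n : ℕ) :
    Set.InjOn (hiveExponent (n := n)) (hiveCone n : Set (Idx n → ℤ)) := by
  intro h hh k hk heq
  funext p
  have h1 : (h p).toNat = (k p).toNat := DFunLike.congr_fun heq p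
  have h2 := IsHive.nonneg hh p
  have h3 := IsHive.nonneg hk p
  omega

/-- The hive monomials form a multiplicative monoid, so the algebra they generate is already their
linear span. Non-negativity of hive entries makes `Int.toNat` additive here. -/
theorem toSubmodule_hiveAlgebra (n : ℕ) : Subalgebra.toSubmodule (hiveAlgebra n) =
    MvPolynomial.restrictSupport ℂ (hiveExponent '' (hiveCone n : Set (Idx n → ℤ))) := by
  have himg : hiveMonomial '' (hiveCone n : Set (Idx n → ℤ)) =
      (fun m => MvPolynomial.monomial m (1 : ℂ)) ''
        (hiveExponent '' (hiveCone n : Set (Idx n → ℤ))) := by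
    rw [Set.image_image]
    exact Set.image_congr fun h _ => hiveMonomial_eq_monomial h
  rw [hiveAlgebra, MvPolynomial.restrictSupport_eq_span, ← himg]
  refine Algebra.adjoin_eq_span_of_subset ℂ (Set.Subset.trans ?_ Submodule.subset_span)
  intro p hp
  induction hp using Submonoid.closure_induction with
  | mem p hp => exact hp
  | one =>
    refine ⟨0, (hiveCone n).zero_mem, ?_⟩
    simp [hiveMonomial]
  | mul p q _ _ hp hq =>
    obtain ⟨h, hh, rfl⟩ := hp
    obtain ⟨k, hk, rfl⟩ := hq
    refine ⟨h + k, (hiveCone n).add_mem hh hk, ?_⟩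
    rw [hiveMonomial, hiveMonomial, hiveMonomial, ← Finset.prod_mul_distrib]
    refine Finset.prod_congr rfl fun p _ => ?_
    rw [← pow_add, Pi.add_apply, Int.toNat_add (IsHive.nonneg hh p) (IsHive.nonneg hk p)]

/-- The algebra and the homogeneous polynomials are both cut out by conditions on the support, so
their intersection corresponds to the intersection of the exponent sets; the weighted degree of an
exponent is its corner coordinate. -/
theorem map_homogeneousPart (n d : ℕ) :
    (homogeneousPart n d).map (hiveAlgebra n).val.toLinearMap =
      MvPolynomial.restrictSupport ℂ
        (hiveExponent '' {h : Idx n → ℤ | IsHive h ∧ h (corner n) = d}) := by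
  have hset : hiveExponent '' {h : Idx n → ℤ | IsHive h ∧ h (corner n) = d} =
      hiveExponent '' (hiveCone n : Set (Idx n → ℤ)) ∩
        {m | Finsupp.weight (Pi.single (corner n) 1 : Idx n → ℕ) m = d} := by
    have hw : ∀ m : Idx n →₀ ℕ,
        Finsupp.weight (Pi.single (corner n) 1 : Idx n → ℕ) m = m (corner n) := by
      intro m
      rw [Finsupp.weight_apply, Finsupp.sum_fintype _ _ (by simp),
        Finset.sum_eq_single (corner n)]
      · simp
      · intro p _ hp
        simp [hp]
      · simp
    ext m
    simp only [Set.mem_image, Set.mem_inter_iff, Set.mem_ofPred_eq, hw]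
    constructor
    · rintro ⟨h, ⟨hh, hd⟩, rfl⟩
      refine ⟨⟨h, hh, rfl⟩, ?_⟩
      change (h (corner n)).toNat = d
      rw [hd, Int.toNat_natCast]
    · rintro ⟨⟨h, hh, rfl⟩, hd⟩
      refine ⟨h, ⟨hh, ?_⟩, rfl⟩
      rw [← hd]
      exact (Int.toNat_of_nonneg (IsHive.nonneg hh _)).symm
  have hrange : LinearMap.range (hiveAlgebra n).val.toLinearMap =
      Subalgebra.toSubmodule (hiveAlgebra n) := by
    ext p
    simp
  rw [homogeneousPart, Submodule.map_comap_eq, hrange, toSubmodule_hiveAlgebra, hset]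
  ext p
  rw [Submodule.mem_inf, MvPolynomial.weightedHomogeneousSubmodule_eq_finsupp_supported]
  exact Set.subset_inter_iff.symm

/-- The homogeneous part of degree `d` has a basis indexed by the hives with corner entry `d`. -/
noncomputable def homogeneousPartBasis (n d : ℕ) :
    Module.Basis (CornerHive n d) ℂ (homogeneousPart n d) :=
  ((MvPolynomial.basisRestrictSupport ℂ _).reindex
    (Equiv.Set.imageOfInjOn hiveExponent {h : Idx n → ℤ | IsHive h ∧ h (corner n) = d}
      ((hiveExponent_injOn n).mono fun _ h => h.1)).symm).map
    (((homogeneousPart n d).equivMapOfInjective (hiveAlgebra n).val.toLinearMap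
      Subtype.val_injective).trans (LinearEquiv.ofEq _ _ (map_homogeneousPart n d))).symm

end HiveAlg

theorem proposition2p3 (n : ℕ) :
    (∀ μ ν : HiveAlg.Diagram n, ∃! c : HiveAlg.Diagram n →₀ ℕ,
      HiveAlg.IsSchurDecomposition μ ν c) ∧
    ∀ d : ℕ, Module.Finite ℂ (HiveAlg.homogeneousPart n d) ∧
      PowerSeries.coeff d (HiveAlg.hpSeries n) =
        ∑ t ∈ HiveAlg.triples n d, HiveAlg.lrCoeff t.1 t.2.1 t.2.2 := by
  refine ⟨fun μ ν => ⟨HiveAlg.goodMultiplicity μ ν,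
    HiveAlg.isSchurDecomposition_goodMultiplicity μ ν, fun c hc =>
      hc.unique (HiveAlg.isSchurDecomposition_goodMultiplicity μ ν)⟩, fun d =>
    ⟨Module.Finite.of_basis (HiveAlg.homogeneousPartBasis n d), ?_⟩⟩
  rw [HiveAlg.hpSeries, PowerSeries.coeff_mk,
    Module.finrank_eq_nat_card_basis (HiveAlg.homogeneousPartBasis n d), HiveAlg.card_cornerHive]
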